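/- Let $n\ge 1$ and $\mu,\mu_c,\kappa>0$. Write $\operatorname{sym}M=\tfrac12(M+M^T)$, $\operatorname{skew}M=\tfrac12(M-M^T)$, $\operatorname{dev}M=M-\tfrac{\operatorname{tr}M}{n}\mathbb 1$ and $\langle M,N\rangle=\operatorname{tr}(M^TN)$ for $M,N\in\mathbb R^{n\times n}$. Let $g$ be the left-$\mathrm{GL}(n)$-invariant, right-$\mathrm O(n)$-invariant Riemannian metric on $\mathrm{GL}(n)$ given by $$g_A(M,N)=\langle A^{-1}M,A^{-1}N\rangle_{\mu,\mu_c,\kappa},\qquad \langle M,N\rangle_{\mu,\mu_c,\kappa}=\mu\,\langle\operatorname{dev}\operatorname{sym}M,\operatorname{dev}\operatorname{sym}N\rangle+\mu_c\,\langle\operatorname{skew}M,\operatorname{skew}N\rangle+\tfrac{\kappa}{n}\operatorname{tr}(M)\operatorname{tr}(N).$$ An admissible curve from $A$ to $B$ is a continuous map $X\colon[a,b]\to\mathrm{GL}(n)$, where $a<b$ are arbitrary real numbers, with $X(a)=A$ and $X(b)=B$, such that for some partition $a=a_0<a_1<\dots<a_{m+1}=b$ each restriction $X|_{[a_j,a_{j+1}]}$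 is continuously differentiable (with one-sided derivatives at the end points) with $\dot X(t)\neq0$ for all $t\in[a_j,a_{j+1}]$. Its length is $L(X)=\int_a^b\sqrt{g_{X(t)}(\dot X(t),\dot X(t))}\,dt$, and the geodesic distance is $\operatorname{dist}_{\mathrm{geod}}(A,B)=\inf_X L(X)\in[0,\infty]$, the infimum being taken over all admissible curves $X$ from $A$ to $B$. Proposition. Let $A,B\in\mathrm{GL}^+(n)=\{A\in\mathbb R^{n\times n}:\det A>0\}$ with $A\neq B$. Then there exists an admissible curve $X$ from $A$ to $B$ with $L(X)=\operatorname{dist}_{\mathrm{geod}}(A,B)$. -/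

import Mathlib

open Set MeasureTheory
open scoped Matrix ENNReal

namespace GLGeod

noncomputable section

/-- The symmetric part `(M + Mᵀ) / 2`. -/
def symPart {n : ℕ} (M : Matrix (Fin n) (Fin n) ℝ) : Matrix (Fin n) (Fin n) ℝ :=
  (1 / 2 : ℝ) • (M + Mᵀ)

/-- The skew symmetric part `(M - Mᵀ) / 2`. -/
def skewPart {n : ℕ} (M : Matrix (Fin n) (Fin n) ℝ) : Matrix (Fin n) (Fin n) ℝ :=
  (1 / 2 : ℝ) • (M - Mᵀ)

/-- The deviator `M - (tr M / n) • 1`. -/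
def dev {n : ℕ} (M : Matrix (Fin n) (Fin n) ℝ) : Matrix (Fin n) (Fin n) ℝ :=
  M - (M.trace / (n : ℝ)) • (1 : Matrix (Fin n) (Fin n) ℝ)

/-- The canonical inner product `⟨M, N⟩ = tr (Mᵀ N)` on `n × n` matrices. -/
def canonicalInner {n : ℕ} (M N : Matrix (Fin n) (Fin n) ℝ) : ℝ :=
  (Mᵀ * N).trace

/-- The isotropic inner product
`μ ⟨dev sym M, dev sym N⟩ + μc ⟨skew M, skew N⟩ + (κ / n) tr M tr N`. -/
def isoInner {n : ℕ} (μ μc κ : ℝ) (M N : Matrix (Fin n) (Fin n) ℝ) : ℝ :=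
  μ * canonicalInner (dev (symPart M)) (dev (symPart N))
    + μc * canonicalInner (skewPart M) (skewPart N)
    + κ / (n : ℝ) * (M.trace * N.trace)

/-- The left-invariant, right-`O(n)`-invariant Riemannian metric on `GL(n)` induced by the
isotropic inner product: `g_A(M, N) = ⟨A⁻¹ M, A⁻¹ N⟩`. It is only used at invertible `A`. -/
def isoMetric {n : ℕ} (μ μc κ : ℝ) (A M N : Matrix (Fin n) (Fin n) ℝ) : ℝ :=
  isoInner μ μc κ (A⁻¹ * M) (A⁻¹ * N)

/-- The restriction of `X` to the closed interval `[a, b]` is continuously differentiable, with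
one-sided derivatives at the end points, and its derivative vanishes nowhere on `[a, b]`. -/
def IsRegularC1On {n : ℕ} (X : ℝ → Matrix (Fin n) (Fin n) ℝ) (a b : ℝ) : Prop :=
  ∃ X' : ℝ → Matrix (Fin n) (Fin n) ℝ, ContinuousOn X' (Icc a b) ∧
    ∀ t ∈ Icc a b, HasDerivWithinAt X (X' t) (Icc a b) t ∧ X' t ≠ 0

/-- `X` restricted to `[a, b]` is a piecewise continuously differentiable (regular) curve in
`GL(n)`: it is continuous with values in `GL(n)`, and for some partition
`a = p 0 < p 1 < ⋯ < p (m + 1) = b` it is regular `C¹` on every closed subinterval. -/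
def IsPiecewiseRegularC1 {n : ℕ} (X : ℝ → Matrix (Fin n) (Fin n) ℝ) (a b : ℝ) : Prop :=
  ContinuousOn X (Icc a b) ∧ (∀ t ∈ Icc a b, (X t).det ≠ 0) ∧
    ∃ (m : ℕ) (p : Fin (m + 2) → ℝ), StrictMono p ∧ p 0 = a ∧ p (Fin.last (m + 1)) = b ∧
      ∀ j : Fin (m + 1), IsRegularC1On X (p j.castSucc) (p j.succ)

/-- The admissible curves from `A` to `B`, over arbitrary parameter intervals `[a, b]`. A curve is
stored as a function on `ℝ`, of which only the restriction to `[a, b]` matters. -/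
structure AdmissibleCurve {n : ℕ} (A B : Matrix (Fin n) (Fin n) ℝ) where
  /-- left end point of the parameter interval -/
  a : ℝ
  /-- right end point of the parameter interval -/
  b : ℝ
  /-- the curve -/
  toFun : ℝ → Matrix (Fin n) (Fin n) ℝ
  piecewise : IsPiecewiseRegularC1 toFun a b
  map_left : toFun a = A
  map_right : toFun b = B

/-- The length `∫ₐᵇ √(g_{X(t)}(X'(t), X'(t))) dt` of an admissible curve with respect to `g`.
The derivative exists at all but finitely many points of `(a, b)`. -/
def curveLength {n : ℕ}
    (g : Matrix (Fin n) (Fin n) ℝ → Matrix (Fin n) (Fin n) ℝ → Matrix (Fin n) (Fin n) ℝ → ℝ)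
    {A B : Matrix (Fin n) (Fin n) ℝ} (X : AdmissibleCurve A B) : ℝ :=
  ∫ t in X.a..X.b, Real.sqrt (g (X.toFun t) (deriv X.toFun t) (deriv X.toFun t))

/-- The geodesic distance with values in `[0, ∞]`: the infimum of the lengths of all admissible
curves from `A` to `B` (`∞` if there is none). -/
def geodDist {n : ℕ}
    (g : Matrix (Fin n) (Fin n) ℝ → Matrix (Fin n) (Fin n) ℝ → Matrix (Fin n) (Fin n) ℝ → ℝ)
    (A B : Matrix (Fin n) (Fin n) ℝ) : ℝ≥0∞ :=
  ⨅ X : AdmissibleCurve A B, ENNReal.ofReal (curveLength g X)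

end

end GLGeod

/-! The argument is a hands-on Hopf–Rinow theorem. Put `Q v = δ (v - vᵀ)` with `δ = (μ + μc) / (2
μ)`. The curve `A exp(t (v - Q v)) exp(t Q v)` is the geodesic from `A` with initial velocity `A v`:
its velocity translated to the identity, `U(t) = exp(-t Q v) v exp(t Q v)`, solves the Euler–Arnold
equation, and it has constant norm because `exp(t Q v)` is orthogonal. The properties of the metric
used for the local theory are collected in `IsGeodesicForm`, so that theory takes place in a Banach
algebra.

The inverse function theorem at `0` and the Gauss lemma `IsGeodesicForm.gauss` give a radius `r`
such that any curve of length at most `r` can be replaced by a single geodesic with the same end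
points that is not longer (`IsGeodesicForm.exists_expMap_eq`). By left invariance the same `r`
serves at every base point. Hence a curve of length at most `N r` can be replaced by a broken
geodesic with `N` segments, whose initial velocities have norm at most `r`
(`IsGeodesicForm.exists_prod_expMap_eq`).

The `N`-tuples of such velocities that lead from `A` to `B` form a compact set, on which the total
norm attains its minimum; the corresponding broken geodesic is a shortest curve. A suitable `N`
comes from one connecting curve, which exists because every matrix of positive determinant is a
product of exponentials (`mem_closure_exp_of_det_pos`), hence also a product of values of `expMap
Q`. -/

namespace GLGeod

open NormedSpace Filter Topology

noncomputable section

section BanachAlgebra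

/-! ### Geodesics of left-invariant metrics on the units of a Banach algebra -/

variable {𝔸 : Type*} [NormedRing 𝔸] [NormedAlgebra ℝ 𝔸]

/-- The geodesic exponential map at the identity, with rotational generator `Q`. -/
def expMap (Q : 𝔸 →L[ℝ] 𝔸) (x : 𝔸) : 𝔸 := exp (x - Q x) * exp (Q x)

/-- The velocity, translated to the identity, at time `1` of the geodesic with initial
velocity `x`. -/
def bodyVelocity (Q : 𝔸 →L[ℝ] 𝔸) (x : 𝔸) : 𝔸 := exp (-Q x) * x * exp (Q x)

/-- The velocity, translated to the identity, of the geodesic with initial velocity `v`. -/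
def bodyCurve (Q : 𝔸 →L[ℝ] 𝔸) (v : 𝔸) (t : ℝ) : 𝔸 := exp (t • -Q v) * v * exp (t • Q v)

variable (Q : 𝔸 →L[ℝ] 𝔸)

@[simp] theorem expMap_zero : expMap Q 0 = 1 := by simp [expMap]

theorem bodyVelocity_smul (v : 𝔸) (t : ℝ) : bodyVelocity Q (t • v) = t • bodyCurve Q v t := by
  simp [bodyVelocity, bodyCurve]

theorem bodyCurve_one (v : 𝔸) : bodyCurve Q v 1 = bodyVelocity Q v := by
  simp [bodyVelocity, bodyCurve]

/-- A left-invariant metric for which `expMap Q` is the geodesic exponential map. -/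
structure IsGeodesicForm (b : 𝔸 →L[ℝ] 𝔸 →L[ℝ] ℝ) : Prop where
  symm : ∀ x y, b x y = b y x
  nonneg : ∀ x, 0 ≤ b x x
  cauchy_schwarz : ∀ x y, |b x y| ≤ √(b x x) * √(b y y)
  conj : ∀ v y z, b (exp (-Q v) * y * exp (Q v)) (exp (-Q v) * z * exp (Q v)) = b y z
  geodesic : ∀ v y, b (v * Q v - Q v * v) y + b v (y * v - v * y) = 0
  isCompact_le : ∀ r : ℝ, IsCompact {x | √(b x x) ≤ r}
  eq_zero : ∀ x, √(b x x) = 0 → x = 0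

/-- Constant speed of geodesics: conjugation by `exp(Q (t • v))` is an isometry of `b`. -/
theorem IsGeodesicForm.bodyCurve_self {Q : 𝔸 →L[ℝ] 𝔸} {b : 𝔸 →L[ℝ] 𝔸 →L[ℝ] ℝ}
    (hb : IsGeodesicForm Q b) (v : 𝔸) (t : ℝ) :
    b (bodyCurve Q v t) (bodyCurve Q v t) = b v v := by
  simpa [bodyCurve] using hb.conj (t • v) v v

variable [CompleteSpace 𝔸]

theorem contDiff_exp_real {m : WithTop ℕ∞} : ContDiff ℝ m (exp : 𝔸 → 𝔸) :=
  contDiff_iff_contDiffAt.2 fun x => (exp_analytic (𝕂 := ℝ) x).contDiffAt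

theorem contDiff_expMap {m : WithTop ℕ∞} : ContDiff ℝ m (expMap Q) :=
  (contDiff_exp_real.comp (contDiff_id.sub Q.contDiff)).mul (contDiff_exp_real.comp Q.contDiff)

theorem contDiff_bodyVelocity {m : WithTop ℕ∞} : ContDiff ℝ m (bodyVelocity Q) :=
  ((contDiff_exp_real.comp Q.contDiff.neg).mul contDiff_id).mul (contDiff_exp_real.comp Q.contDiff)

theorem continuous_expMap : Continuous (expMap Q) := (contDiff_expMap Q (m := 0)).continuous

theorem exp_mul_exp_neg (x : 𝔸) : exp x * exp (-x) = 1 := by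
  let _ := NormedAlgebra.restrictScalars ℚ ℝ 𝔸
  rw [← exp_add_of_commute (Commute.neg_right (Commute.refl x)), add_neg_cancel, exp_zero]

theorem exp_neg_mul_exp (x : 𝔸) : exp (-x) * exp x = 1 := by
  simpa using exp_mul_exp_neg (-x)

theorem isUnit_expMap (x : 𝔸) : IsUnit (expMap Q x) := by
  let _ := NormedAlgebra.restrictScalars ℚ ℝ 𝔸
  exact (isUnit_exp _).mul (isUnit_exp _)

theorem hasStrictFDerivAt_expMap_zero :
    HasStrictFDerivAt (expMap Q) (ContinuousLinearMap.id ℝ 𝔸) 0 := by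
  have h0 : HasStrictFDerivAt (exp : 𝔸 → 𝔸) (1 : 𝔸 →L[ℝ] 𝔸) 0 := hasStrictFDerivAt_exp_zero
  have h1 : HasStrictFDerivAt (fun x => exp (x - Q x)) (ContinuousLinearMap.id ℝ _ - Q) 0 :=
    HasStrictFDerivAt.comp (f := fun x => x - Q x) 0 (by simpa using h0)
      ((hasStrictFDerivAt_id _).sub Q.hasStrictFDerivAt)
  have h2 : HasStrictFDerivAt (fun x => exp (Q x)) Q 0 :=
    HasStrictFDerivAt.comp (f := fun x => Q x) 0 (by simpa using h0) Q.hasStrictFDerivAt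
  refine (h1.mul' h2).congr_fderiv ?_
  ext1 x
  simp

theorem hasDerivAt_bodyCurve (v : 𝔸) (t : ℝ) :
    HasDerivAt (bodyCurve Q v) (bodyCurve Q v t * Q v - Q v * bodyCurve Q v t) t := by
  have h1 := hasDerivAt_exp_smul_const' (-Q v) t
  have h2 := hasDerivAt_exp_smul_const (Q v) t
  refine ((h1.mul_const v).mul h2).congr_deriv ?_
  simp only [bodyCurve]
  noncomm_ring

theorem hasDerivAt_expMap_smul (v : 𝔸) (t : ℝ) :
    HasDerivAt (fun t : ℝ => expMap Q (t • v)) (expMap Q (t • v) * bodyCurve Q v t) t := by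
  have h1 := hasDerivAt_exp_smul_const (v - Q v) t
  have h2 := hasDerivAt_exp_smul_const' (Q v) t
  convert h1.mul h2 using 1
  · ext1 s; simp [expMap, smul_sub]
  · have h3 := exp_mul_exp_neg (t • Q v)
    simp only [bodyCurve, expMap, map_smul, smul_neg, smul_sub, mul_assoc]
    rw [← mul_assoc (exp (t • Q v)), h3]
    noncomm_ring

theorem continuous_bodyCurve (v : 𝔸) : Continuous (bodyCurve Q v) :=
  continuous_iff_continuousAt.2 fun t => (hasDerivAt_bodyCurve Q v t).continuousAt

/-! ### Derivatives of the exponential map and the Gauss lemma -/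

theorem fderiv_expMap_smul_apply (v : 𝔸) (t : ℝ) :
    fderiv ℝ (expMap Q) (t • v) v = expMap Q (t • v) * bodyCurve Q v t := by
  have h1 : HasDerivAt (fun t : ℝ => t • v) v t := by simpa using (hasDerivAt_id t).smul_const v
  have h2 := ((contDiff_expMap Q (m := 1)).differentiable (by simp)
    (t • v)).hasFDerivAt.comp_hasDerivAt t h1
  exact h2.unique (hasDerivAt_expMap_smul Q v t)

/-- The radial derivative is the velocity of the geodesic at time `1`. Being an identity in `x`, it
can be differentiated once more, which produces the second derivative needed for the Gauss lemma. -/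
theorem fderiv_expMap_self (x : 𝔸) :
    fderiv ℝ (expMap Q) x x = expMap Q x * bodyVelocity Q x := by
  simpa [bodyCurve, bodyVelocity] using fderiv_expMap_smul_apply Q x 1

theorem hasFDerivAt_fderiv_expMap (x : 𝔸) :
    HasFDerivAt (fderiv ℝ (expMap Q)) (fderiv ℝ (fderiv ℝ (expMap Q)) x) x :=
  (((contDiff_expMap Q (m := 2)).fderiv_right (m := 1) (by norm_num)).differentiable
    (by simp) x).hasFDerivAt

/-- The derivative of `fderiv_expMap_self`. -/
theorem fderiv_fderiv_expMap (x w : 𝔸) :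
    fderiv ℝ (fderiv ℝ (expMap Q)) x x w + fderiv ℝ (expMap Q) x w =
      fderiv ℝ (expMap Q) x w * bodyVelocity Q x
        + expMap Q x * fderiv ℝ (bodyVelocity Q) x w := by
  have hF := contDiff_expMap Q (m := 2)
  have hsymm : IsSymmSndFDerivAt ℝ (expMap Q) x := hF.contDiffAt.isSymmSndFDerivAt (by simp)
  have h1 := (hasFDerivAt_fderiv_expMap Q x).clm_apply (hasFDerivAt_id x)
  have h2 := (hF.differentiable (by simp) x).hasFDerivAt.mul'
    ((contDiff_bodyVelocity Q (m := 1)).differentiable (by simp) x).hasFDerivAt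
  have h3 := congrArg (fun L => L w)
    (h1.unique (h2.congr_of_eventuallyEq (Eventually.of_forall (fderiv_expMap_self Q))))
  rw [hsymm.eq]
  simp at h3
  rw [add_comm, h3, add_comm]

/-- The inverse of the geodesic `t ↦ expMap Q (t • v)`. -/
def expMapInvCurve (v : 𝔸) (t : ℝ) : 𝔸 := exp (t • -Q v) * exp (t • -(v - Q v))

theorem expMapInvCurve_mul (v : 𝔸) (t : ℝ) : expMapInvCurve Q v t * expMap Q (t • v) = 1 := by
  have h1 : exp (t • -(v - Q v)) * exp (t • v - Q (t • v)) = 1 := by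
    simpa [smul_sub] using exp_neg_mul_exp (t • v - Q (t • v))
  have h2 : exp (t • -Q v) * exp (Q (t • v)) = 1 := by
    simpa using exp_neg_mul_exp (Q (t • v))
  rw [expMapInvCurve, expMap, mul_assoc, ← mul_assoc (exp (t • -(v - Q v))), h1, one_mul, h2]

theorem hasDerivAt_expMapInvCurve (v : 𝔸) (t : ℝ) :
    HasDerivAt (expMapInvCurve Q v) (-(bodyCurve Q v t * expMapInvCurve Q v t)) t := by
  have h1 := hasDerivAt_exp_smul_const (-Q v) t
  have h2 := hasDerivAt_exp_smul_const' (-(v - Q v)) t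
  refine (h1.mul h2).congr_deriv ?_
  have h3 : exp (t • Q v) * exp (t • -Q v) = 1 := by simpa using exp_mul_exp_neg (t • Q v)
  simp only [expMapInvCurve, bodyCurve]
  rw [mul_assoc (_ * v), ← mul_assoc (exp (t • Q v)), h3]
  noncomm_ring

/-- The derivative of `expMap Q` in direction `w` along a geodesic, translated to the identity. -/
def jacobiCurve (v w : 𝔸) (t : ℝ) : 𝔸 := expMapInvCurve Q v t * fderiv ℝ (expMap Q) (t • v) w

theorem hasDerivAt_jacobiCurve (v w : 𝔸) (t : ℝ) :
    HasDerivAt (jacobiCurve Q v w) (-(bodyCurve Q v t * jacobiCurve Q v w t)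
      + expMapInvCurve Q v t * fderiv ℝ (fderiv ℝ (expMap Q)) (t • v) v w) t := by
  have h1 : HasDerivAt (fun t : ℝ => t • v) v t := by
    simpa using (hasDerivAt_id t).smul_const v
  have h2 : HasDerivAt (fun t : ℝ => fderiv ℝ (expMap Q) (t • v) w)
      (fderiv ℝ (fderiv ℝ (expMap Q)) (t • v) v w) t := by
    have h3 : HasDerivAt (fun t : ℝ => fderiv ℝ (expMap Q) (t • v))
        (fderiv ℝ (fderiv ℝ (expMap Q)) (t • v) v) t :=
      HasFDerivAt.comp_hasDerivAt (l := fderiv ℝ (expMap Q)) t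
        (hasFDerivAt_fderiv_expMap Q (t • v)) h1
    exact (ContinuousLinearMap.apply ℝ 𝔸 w).hasFDerivAt.comp_hasDerivAt t h3
  refine ((hasDerivAt_expMapInvCurve Q v t).mul h2).congr_deriv ?_
  rw [jacobiCurve, neg_mul, mul_assoc]

namespace IsGeodesicForm

variable {Q} {b : 𝔸 →L[ℝ] 𝔸 →L[ℝ] ℝ}

/-- Conjugation by `exp(Q (t • v))` fixes `Q v` and preserves `b`, so it carries the identity
`geodesic` from time `0` to time `t`. Together with `hasDerivAt_bodyCurve` this is the Euler–Arnold
equation. -/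
theorem bodyCurve_geodesic (hb : IsGeodesicForm Q b) (v : 𝔸) (t : ℝ) (y : 𝔸) :
    b (bodyCurve Q v t * Q v - Q v * bodyCurve Q v t) y
      + b (bodyCurve Q v t) (y * bodyCurve Q v t - bodyCurve Q v t * y) = 0 := by
  let _ := NormedAlgebra.restrictScalars ℚ ℝ 𝔸
  set E := exp (Q (t • v)) with hE
  set E' := exp (-Q (t • v)) with hE'
  have h1 : E * E' = 1 := exp_mul_exp_neg _
  have h2 : E' * E = 1 := exp_neg_mul_exp _
  have hU : bodyCurve Q v t = E' * v * E := by simp [bodyCurve, hE, hE']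
  have hc : Commute (Q v) (Q (t • v)) := by
    rw [map_smul]; exact (Commute.refl _).smul_right t
  have c1 : Q v * E = E * Q v := hc.exp_right
  have c2 : Q v * E' = E' * Q v := hc.neg_right.exp_right
  have e1 : bodyCurve Q v t * Q v - Q v * bodyCurve Q v t = E' * (v * Q v - Q v * v) * E := by
    rw [hU, mul_assoc _ E, ← c1, ← mul_assoc (Q v), ← mul_assoc (Q v), c2]
    noncomm_ring
  -- With `y` written as a conjugate, `conj` removes `E'` and `E` from both arguments.
  have e2 : y = E' * (E * y * E') * E := by
    rw [← mul_assoc, ← mul_assoc, h2, one_mul, mul_assoc, h2, mul_one]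
  have e3 : y * bodyCurve Q v t - bodyCurve Q v t * y =
      E' * ((E * y * E') * v - v * (E * y * E')) * E := by
    rw [hU]
    calc _ = (E' * E) * y * E' * v * E - E' * v * E * y * (E' * E) := by
          rw [h2]; noncomm_ring
      _ = _ := by noncomm_ring
  rw [e1, e3, hU]
  nth_rewrite 1 [e2]
  rw [hb.conj, hb.conj]
  exact hb.geodesic v _

/-- This is half the derivative of `b (R y) (R y) = b y y` at `x` in direction `w`, where `R` is
`bodyVelocity Q`. -/
theorem apply_fderiv_bodyVelocity (hb : IsGeodesicForm Q b) (x w : 𝔸) :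
    b (bodyVelocity Q x) (fderiv ℝ (bodyVelocity Q) x w) = b x w := by
  have hR := ((contDiff_bodyVelocity Q (m := 1)).differentiable (by simp) x).hasFDerivAt
  have h1 := (b.hasFDerivAt.comp x hR).clm_apply hR
  have h2 := (b.hasFDerivAt (x := x)).clm_apply (hasFDerivAt_id x)
  have h3 := congrArg (fun L => L w)
    (h1.unique (h2.congr_of_eventuallyEq (Eventually.of_forall fun y => hb.conj y y y)))
  simp at h3
  rw [hb.symm (fderiv ℝ (bodyVelocity Q) x w), hb.symm w] at h3
  linarith

/-- Product rule, in which the Euler–Arnold equation tested against `J = jacobiCurve Q v w t` trades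
the derivative of `U = bodyCurve Q v t` for a commutator; this turns the term `-U J` into `-J U`. -/
theorem hasDerivAt_jacobiCurve (hb : IsGeodesicForm Q b) (v w : 𝔸) (t : ℝ) :
    HasDerivAt (fun t => b (bodyCurve Q v t) (t • jacobiCurve Q v w t) - t * b v w)
      (t * b (bodyCurve Q v t) (-(jacobiCurve Q v w t * bodyCurve Q v t)
        + expMapInvCurve Q v t * fderiv ℝ (fderiv ℝ (expMap Q)) (t • v) v w)
        + b (bodyCurve Q v t) (jacobiCurve Q v w t) - b v w) t := by
  have h1 := b.hasFDerivAt.comp_hasDerivAt t (hasDerivAt_bodyCurve Q v t)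
  have h2 := (hasDerivAt_id t).smul (GLGeod.hasDerivAt_jacobiCurve Q v w t)
  refine ((h1.clm_apply h2).sub ((hasDerivAt_id t).mul_const (b v w))).congr_deriv ?_
  have h3 := hb.bodyCurve_geodesic v t (jacobiCurve Q v w t)
  simp only [map_add, map_sub, map_neg, map_smul, smul_eq_mul, one_smul, one_mul, id,
    _root_.sub_apply, Function.comp, Pi.smul_apply'] at h3 ⊢
  linear_combination t * h3

/-- The second derivative of `expMap Q` is eliminated by `fderiv_fderiv_expMap` at `t • v`, and what
remains is `b U (dR w) - b v w` with `R = bodyVelocity Q`. It vanishes by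
`apply_fderiv_bodyVelocity`, which holds with a factor `t` on both sides; hence `t ≠ 0`. -/
theorem hasDerivAt_jacobiCurve_of_ne_zero (hb : IsGeodesicForm Q b) (v w : 𝔸) {t : ℝ}
    (ht : t ≠ 0) :
    HasDerivAt (fun t => b (bodyCurve Q v t) (t • jacobiCurve Q v w t) - t * b v w) 0 t := by
  refine (hb.hasDerivAt_jacobiCurve v w t).congr_deriv ?_
  have h1 := fderiv_fderiv_expMap Q (t • v) w
  have h2 := hb.apply_fderiv_bodyVelocity (t • v) w
  have h4 : fderiv ℝ (fderiv ℝ (expMap Q)) (t • v) (t • v) w =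
      t • fderiv ℝ (fderiv ℝ (expMap Q)) (t • v) v w := by simp
  rw [bodyVelocity_smul, h4] at h1
  rw [bodyVelocity_smul] at h2
  have h5 : t • (expMapInvCurve Q v t * fderiv ℝ (fderiv ℝ (expMap Q)) (t • v) v w) =
      t • (jacobiCurve Q v w t * bodyCurve Q v t) + fderiv ℝ (bodyVelocity Q) (t • v) w
        - jacobiCurve Q v w t := by
    rw [← mul_smul_comm, eq_sub_of_add_eq h1]
    simp only [jacobiCurve, mul_sub, mul_add, ← mul_assoc, expMapInvCurve_mul, one_mul,
      mul_smul_comm]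
  have h6 : b (bodyCurve Q v t) (fderiv ℝ (bodyVelocity Q) (t • v) w) = b v w := by
    simp only [map_smul, _root_.smul_apply, smul_eq_mul] at h2
    exact mul_left_cancel₀ ht h2
  have h7 := congrArg (b (bodyCurve Q v t)) h5
  simp only [map_add, map_sub, map_neg, map_smul, smul_eq_mul] at h7 ⊢
  linear_combination h7 + h6

/-- The Gauss lemma. -/
theorem gauss (hb : IsGeodesicForm Q b) (v : 𝔸) {w u : 𝔸}
    (h : fderiv ℝ (expMap Q) v w = expMap Q v * u) : b (bodyVelocity Q v) u = b v w := by
  -- The function vanishes at `0` and has zero derivative on the open interval, so by the mean value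
  -- theorem it vanishes at `1`; that is the claim.
  have hc := exists_hasDerivAt_eq_slope
    (fun t => b (bodyCurve Q v t) (t • jacobiCurve Q v w t) - t * b v w) (fun _ => 0)
    (zero_lt_one' ℝ) (fun t _ => (hb.hasDerivAt_jacobiCurve v w t).continuousAt.continuousWithinAt)
    (fun t ht => hb.hasDerivAt_jacobiCurve_of_ne_zero v w ht.1.ne')
  have hZ1 : jacobiCurve Q v w 1 = u := by
    have := expMapInvCurve_mul Q v 1
    rw [one_smul] at this
    rw [jacobiCurve, one_smul, h, ← mul_assoc, this, one_mul]
  obtain ⟨c, hc, hc'⟩ := hc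
  simp only [hZ1, bodyCurve_one, one_smul, zero_smul, map_zero, zero_mul, one_mul, sub_zero,
    div_one] at hc'
  linarith

/-- The radial part of the velocity is bounded by the speed. -/
theorem abs_le_of_fderiv_eq (hb : IsGeodesicForm Q b) (v : 𝔸) {w u : 𝔸}
    (h : fderiv ℝ (expMap Q) v w = expMap Q v * u) : |b v w| ≤ √(b v v) * √(b u u) := by
  have := hb.cauchy_schwarz (bodyVelocity Q v) u
  rwa [hb.gauss v h, bodyVelocity, hb.conj] at this

end IsGeodesicForm

end BanachAlgebra

/-! ### Curves of units, normal charts and replacement by broken geodesics -/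

section BanachAlgebra

variable {𝔸 : Type*} [NormedRing 𝔸] [NormedAlgebra ℝ 𝔸]

theorem continuous_sqrt_form (b : 𝔸 →L[ℝ] 𝔸 →L[ℝ] ℝ) : Continuous fun x => √(b x x) :=
  (b.continuous.clm_apply continuous_id).sqrt

/-- On `[s, t]`, the curve `c` of units has a right derivative, given by its velocity `u`
translated to the identity, and the speed is integrable. -/
structure HasBodyVelocity (b : 𝔸 →L[ℝ] 𝔸 →L[ℝ] ℝ) (c u : ℝ → 𝔸) (s t : ℝ) : Prop where
  continuousOn : ContinuousOn c (Icc s t)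
  isUnit : ∀ τ ∈ Icc s t, IsUnit (c τ)
  hasDerivWithinAt : ∀ τ ∈ Ico s t, HasDerivWithinAt c (c τ * u τ) (Ioi τ) τ
  integrableOn : IntegrableOn (fun τ => √(b (u τ) (u τ))) (Icc s t)

namespace HasBodyVelocity

variable {b : 𝔸 →L[ℝ] 𝔸 →L[ℝ] ℝ} {c u : ℝ → 𝔸} {s t : ℝ}

theorem mono (h : HasBodyVelocity b c u s t) {s' t' : ℝ} (hs : s ≤ s') (ht : t' ≤ t) :
    HasBodyVelocity b c u s' t' where
  continuousOn := h.continuousOn.mono (Icc_subset_Icc hs ht)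
  isUnit τ hτ := h.isUnit τ (Icc_subset_Icc hs ht hτ)
  hasDerivWithinAt τ hτ := h.hasDerivWithinAt τ (Ico_subset_Ico hs ht hτ)
  integrableOn := h.integrableOn.mono_set (Icc_subset_Icc hs ht)

theorem const_mul (h : HasBodyVelocity b c u s t) {a : 𝔸} (ha : IsUnit a) :
    HasBodyVelocity b (fun τ => a * c τ) u s t where
  continuousOn := continuousOn_const.mul h.continuousOn
  isUnit τ hτ := ha.mul (h.isUnit τ hτ)
  hasDerivWithinAt τ hτ := by
    simpa only [mul_assoc] using (h.hasDerivWithinAt τ hτ).const_mul a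
  integrableOn := h.integrableOn

theorem intervalIntegrable (h : HasBodyVelocity b c u s t) (hst : s ≤ t) :
    IntervalIntegrable (fun τ => √(b (u τ) (u τ))) volume s t :=
  (intervalIntegrable_iff_integrableOn_Icc_of_le hst).2 h.integrableOn

/-- Two consecutive curves. -/
theorem trans (h : HasBodyVelocity b c u s t) {t' : ℝ} (h' : HasBodyVelocity b c u t t')
    (hst : s ≤ t) (htt' : t ≤ t') : HasBodyVelocity b c u s t' where
  continuousOn := by
    rw [← Icc_union_Icc_eq_Icc hst htt']
    exact h.continuousOn.union_of_isClosed h'.continuousOn isClosed_Icc isClosed_Icc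
  isUnit τ hτ := (le_total τ t).elim (fun hle => h.isUnit τ ⟨hτ.1, hle⟩)
    (fun hle => h'.isUnit τ ⟨hle, hτ.2⟩)
  hasDerivWithinAt τ hτ := (lt_or_ge τ t).elim (fun hlt => h.hasDerivWithinAt τ ⟨hτ.1, hlt⟩)
    (fun hle => h'.hasDerivWithinAt τ ⟨hle, hτ.2⟩)
  integrableOn := by
    rw [← Icc_union_Icc_eq_Icc hst htt']
    exact h.integrableOn.union h'.integrableOn

end HasBodyVelocity

variable {Q : 𝔸 →L[ℝ] 𝔸} {b : 𝔸 →L[ℝ] 𝔸 →L[ℝ] ℝ}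

/-- `log` inverts the exponential map between the open set `Ω` and a neighbourhood of the closed
`r`-ball. -/
structure IsNormalChart (Q : 𝔸 →L[ℝ] 𝔸) (b : 𝔸 →L[ℝ] 𝔸 →L[ℝ] ℝ) (r : ℝ) (log : 𝔸 → 𝔸)
    (Ω : Set 𝔸) : Prop where
  isOpen : IsOpen Ω
  differentiableAt : ∀ g ∈ Ω, DifferentiableAt ℝ log g
  expMap_log : ∀ g ∈ Ω, expMap Q (log g) = g
  expMap_mem : ∀ x, √(b x x) ≤ r → expMap Q x ∈ Ω
  log_expMap : ∀ x, √(b x x) ≤ r → log (expMap Q x) = x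

namespace IsGeodesicForm

/-- Small balls are contained in any given neighbourhood of `0`. -/
theorem exists_ball_subset (hb : IsGeodesicForm Q b) {U : Set 𝔸} (hU : U ∈ 𝓝 0) :
    ∃ r > 0, {x | √(b x x) ≤ r} ⊆ U := by
  obtain ⟨V, hVU, hV, h0⟩ := mem_nhds_iff.1 hU
  rcases Set.eq_empty_or_nonempty ({x | √(b x x) ≤ 1} \ V) with he | hne
  · exact ⟨1, one_pos, (sdiff_eq_empty.1 he).trans hVU⟩
  obtain ⟨x, hx, hmin⟩ := ((hb.isCompact_le 1).diff hV).exists_isMinOn hne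
    (continuous_sqrt_form b).continuousOn
  have hpos : 0 < √(b x x) := by
    refine lt_of_le_of_ne (Real.sqrt_nonneg _) fun h => hx.2 ?_
    rw [hb.eq_zero x h.symm]
    exact h0
  -- Here `x` has least norm among the points of the unit ball outside `V`; a ball of smaller radius
  -- avoids them all.
  refine ⟨min 1 (√(b x x) / 2), by positivity, fun y hy => hVU ?_⟩
  by_contra hyV
  have h1 : √(b y y) ≤ _ := hy
  have h2 : √(b x x) ≤ √(b y y) := hmin ⟨h1.trans (min_le_left _ _), hyV⟩
  have h3 := h1.trans (min_le_right _ _)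
  linarith

variable [CompleteSpace 𝔸]

/-- Inverse function theorem at `0`, where `expMap Q` has derivative the identity. The target is
shrunk to the points where the local inverse is differentiable, and compactness of the `b`-balls
puts a closed one inside the chart. -/
theorem exists_isNormalChart (hb : IsGeodesicForm Q b) :
    ∃ r > 0, ∃ log Ω, IsNormalChart Q b r log Ω := by
  have hF : ContDiffAt ℝ 1 (expMap Q) 0 := (contDiff_expMap Q).contDiffAt
  have hF' : HasFDerivAt (expMap Q) ((ContinuousLinearEquiv.refl ℝ 𝔸 : 𝔸 ≃L[ℝ] 𝔸) : 𝔸 →L[ℝ] 𝔸) 0 :=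
    (hasStrictFDerivAt_expMap_zero Q).hasFDerivAt
  let e := hF.toOpenPartialHomeomorph (expMap Q) hF' one_ne_zero
  have he : ∀ x, e x = expMap Q x := fun _ => rfl
  have h0 : (0 : 𝔸) ∈ e.source := hF.mem_toOpenPartialHomeomorph_source hF' one_ne_zero
  have hs : ContDiffAt ℝ 1 e.symm (expMap Q 0) := hF.to_localInverse hF' one_ne_zero
  have hd : ∀ᶠ g in 𝓝 (expMap Q 0), DifferentiableAt ℝ e.symm g :=
    (hs.eventually (by simp)).mono fun g hg => hg.differentiableAt one_ne_zero
  obtain ⟨W, hW, hWo, h1⟩ := mem_nhds_iff.1 hd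
  obtain ⟨r, hr, hsub⟩ := hb.exists_ball_subset (Filter.inter_mem (e.open_source.mem_nhds h0)
    ((continuous_expMap Q).continuousAt.preimage_mem_nhds (hWo.mem_nhds h1)))
  exact ⟨r, hr, e.symm, e.target ∩ W, e.open_target.inter hWo, fun g hg => hW hg.2,
    fun g hg => e.right_inv hg.1, fun x hx => ⟨e.map_source (hsub hx).1, (hsub hx).2⟩,
    fun x hx => e.left_inv (hsub hx).1⟩

variable {r : ℝ} {log : 𝔸 → 𝔸} {Ω : Set 𝔸}

theorem fderiv_expMap_fderiv_log (hlog : IsNormalChart Q b r log Ω) {g : 𝔸} (hg : g ∈ Ω) (w : 𝔸) :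
    fderiv ℝ (expMap Q) (log g) (fderiv ℝ log g w) = w := by
  have h1 := ((contDiff_expMap Q (m := 1)).differentiable (by simp) (log g)).hasFDerivAt.comp g
    (hlog.differentiableAt g hg).hasFDerivAt
  have h2 : HasFDerivAt (expMap Q ∘ log) (ContinuousLinearMap.id ℝ 𝔸) g :=
    (hasFDerivAt_id g).congr_of_eventuallyEq
      (Filter.mem_of_superset (hlog.isOpen.mem_nhds hg) fun x hx => hlog.expMap_log x hx)
  exact congrArg (fun L => L w) (h1.unique h2)

/-- Along a curve in a normal chart, the (regularised) radius grows at most as fast as the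
length. -/
theorem sqrt_log_sub_le (hb : IsGeodesicForm Q b) (hlog : IsNormalChart Q b r log Ω)
    {c u : ℝ → 𝔸} {s t : ℝ} (hc : HasBodyVelocity b c u s t) (hst : s ≤ t)
    (hΩ : ∀ τ ∈ Icc s t, c τ ∈ Ω) {ε : ℝ} (hε : 0 < ε) :
    √(ε + b (log (c t)) (log (c t))) - √(ε + b (log (c s)) (log (c s)))
      ≤ ∫ τ in s..t, √(b (u τ) (u τ)) := by
  have hlogc : ContinuousOn (fun τ => log (c τ)) (Icc s t) := fun τ hτ =>
    (hlog.differentiableAt _ (hΩ τ hτ)).continuousAt.comp_continuousWithinAt (hc.continuousOn τ hτ)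
  have hnn : ∀ x, 0 ≤ b x x := hb.nonneg
  -- Adding `ε` under the root keeps the radius differentiable where the curve passes through the
  -- identity.
  refine intervalIntegral.sub_le_integral_of_hasDeriv_right_of_le_Ico
    (g := fun τ => √(ε + b (log (c τ)) (log (c τ))))
    (g' := fun τ => b (log (c τ)) (fderiv ℝ log (c τ) (c τ * u τ))
      / √(ε + b (log (c τ)) (log (c τ)))) hst ?_ ?_ hc.integrableOn ?_
  · exact (continuousOn_const.add
      ((b.continuous.comp_continuousOn hlogc).clm_apply hlogc)).sqrt
  · intro τ hτ
    have h1 : HasDerivWithinAt (fun τ => log (c τ)) (fderiv ℝ log (c τ) (c τ * u τ)) (Ioi τ) τ :=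
      (hlog.differentiableAt _ (hΩ τ ⟨hτ.1, hτ.2.le⟩)).hasFDerivAt.comp_hasDerivWithinAt τ
        (hc.hasDerivWithinAt τ hτ)
    have h2 : HasDerivWithinAt (fun τ => b (log (c τ)))
        (b (fderiv ℝ log (c τ) (c τ * u τ))) (Ioi τ) τ :=
      b.hasFDerivAt.comp_hasDerivWithinAt τ h1
    have h3 := ((h2.clm_apply h1).const_add ε).sqrt (by have := hnn (log (c τ)); positivity)
    refine h3.congr_deriv ?_
    rw [hb.symm (fderiv ℝ log (c τ) (c τ * u τ)), ← two_mul, mul_div_mul_left _ _ two_ne_zero]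
  · intro τ hτ
    have hg := hΩ τ ⟨hτ.1, hτ.2.le⟩
    have hpos : 0 < √(ε + b (log (c τ)) (log (c τ))) :=
      Real.sqrt_pos.2 (by have := hnn (log (c τ)); positivity)
    -- The derivative of `expMap Q` maps the velocity of `log ∘ c` to that of `c`, so the Gauss
    -- lemma bounds the radial component by the speed.
    have h1 := hb.abs_le_of_fderiv_eq (log (c τ)) (u := u τ)
      ((fderiv_expMap_fderiv_log hlog hg (c τ * u τ)).trans (by rw [hlog.expMap_log _ hg]))
    rw [div_le_iff₀ hpos, mul_comm]
    refine (le_abs_self _).trans (h1.trans ?_)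
    gcongr
    linarith

/-- A curve from the identity shorter than the radius of a normal chart is not shorter than the
geodesic with the same end points. -/
theorem exists_expMap_eq (hb : IsGeodesicForm Q b) (hlog : IsNormalChart Q b r log Ω)
    {c u : ℝ → 𝔸} {s t : ℝ} (hc : HasBodyVelocity b c u s t) (hst : s ≤ t) (h1 : c s = 1)
    (hl : ∫ τ in s..t, √(b (u τ) (u τ)) ≤ r) :
    ∃ v, √(b v v) ≤ ∫ τ in s..t, √(b (u τ) (u τ)) ∧ expMap Q v = c t := by
  set l := ∫ τ in s..t, √(b (u τ) (u τ)) with hl_def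
  have hl0 : 0 ≤ l := intervalIntegral.integral_nonneg hst fun _ _ => Real.sqrt_nonneg _
  have h0r : √(b 0 0) ≤ r := by simpa using hl0.trans hl
  have hlog1 : log 1 = 0 := by simpa using hlog.log_expMap 0 h0r
  have h1Ω : (1 : 𝔸) ∈ Ω := by simpa using hlog.expMap_mem 0 h0r
  have key : ∀ τ ∈ Icc s t, (∀ σ ∈ Icc s τ, c σ ∈ Ω) → √(b (log (c τ)) (log (c τ))) ≤ l := by
    intro τ hτ hΩ
    -- The regularisation is `ε ^ 2`, so that the initial radius is exactly `ε`.
    refine le_of_forall_pos_le_add fun ε hε => ?_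
    have h2 := hb.sqrt_log_sub_le hlog (hc.mono le_rfl hτ.2) hτ.1 hΩ (pow_pos hε 2)
    rw [h1, hlog1, map_zero, add_zero, Real.sqrt_sq hε.le] at h2
    have h3 : ∫ τ in s..τ, √(b (u τ) (u τ)) ≤ l :=
      intervalIntegral.integral_mono_interval le_rfl hτ.1 hτ.2
        (Eventually.of_forall fun _ => Real.sqrt_nonneg _) (hc.intervalIntegrable hst)
    have h4 : √(b (log (c τ)) (log (c τ))) ≤ √(ε ^ 2 + b (log (c τ)) (log (c τ))) :=
      Real.sqrt_le_sqrt (by nlinarith)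
    linarith
  -- Otherwise there is a first exit time `τ₀`. Before it `c` stays in the image of the closed
  -- `l`-ball, which is compact; so `c τ₀` lies in that image as well, hence in `Ω` because `l ≤ r`.
  have hall : ∀ τ ∈ Icc s t, c τ ∈ Ω := by
    by_contra! hne
    have hT : IsCompact (Icc s t ∩ c ⁻¹' Ωᶜ) :=
      isCompact_Icc.of_isClosed_subset
        (hc.continuousOn.preimage_isClosed_of_isClosed isClosed_Icc hlog.isOpen.isClosed_compl)
        inter_subset_left
    obtain ⟨τ₀, hτ₀, hleast⟩ := hT.exists_isLeast (by simpa [Set.Nonempty] using hne)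
    have hlt : s < τ₀ := hτ₀.1.1.lt_of_ne (by rintro rfl; exact hτ₀.2 (h1 ▸ h1Ω))
    have hΩ : ∀ σ ∈ Ico s τ₀, c σ ∈ Ω := fun σ hσ => by
      by_contra h
      exact absurd (hleast ⟨⟨hσ.1, hσ.2.le.trans hτ₀.1.2⟩, h⟩) (not_le.2 hσ.2)
    have hK : IsClosed (expMap Q '' {x | √(b x x) ≤ l}) :=
      ((hb.isCompact_le l).image (continuous_expMap Q)).isClosed
    have hmaps : c '' Ico s τ₀ ⊆ expMap Q '' {x | √(b x x) ≤ l} := by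
      rintro _ ⟨σ, hσ, rfl⟩
      exact ⟨log (c σ), key σ ⟨hσ.1, hσ.2.le.trans hτ₀.1.2⟩
        fun ρ hρ => hΩ ρ ⟨hρ.1, hρ.2.trans_lt hσ.2⟩, hlog.expMap_log _ (hΩ σ hσ)⟩
    have hcl : closure (Ico s τ₀) = Icc s τ₀ := closure_Ico hlt.ne
    have hcont : ContinuousOn c (closure (Ico s τ₀)) := by
      rw [hcl]; exact hc.continuousOn.mono (Icc_subset_Icc_right hτ₀.1.2)
    obtain ⟨x, hx, hxc⟩ := hK.closure_subset_iff.2 hmaps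
      (hcont.image_closure ⟨τ₀, hcl ▸ right_mem_Icc.2 hlt.le, rfl⟩)
    exact hτ₀.2 (hxc ▸ hlog.expMap_mem x (le_trans hx hl))
  exact ⟨log (c t), key t (right_mem_Icc.2 hst) hall,
    hlog.expMap_log _ (hall t (right_mem_Icc.2 hst))⟩

/-- A curve can be replaced by a broken geodesic that is not longer. -/
theorem exists_prod_expMap_eq (hb : IsGeodesicForm Q b) (hlog : IsNormalChart Q b r log Ω)
    {c u : ℝ → 𝔸} (hr : 0 ≤ r) (N : ℕ) : ∀ {s t : ℝ}, HasBodyVelocity b c u s t → s ≤ t →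
    ∫ τ in s..t, √(b (u τ) (u τ)) ≤ N * r →
    ∃ v : Fin N → 𝔸, (∀ i, √(b (v i) (v i)) ≤ r) ∧
      ∑ i, √(b (v i) (v i)) ≤ ∫ τ in s..t, √(b (u τ) (u τ)) ∧
      c t = c s * (List.ofFn fun i => expMap Q (v i)).prod := by
  have single : ∀ {s t : ℝ}, HasBodyVelocity b c u s t → s ≤ t →
      ∫ τ in s..t, √(b (u τ) (u τ)) ≤ r →
      ∃ v, √(b v v) ≤ ∫ τ in s..t, √(b (u τ) (u τ)) ∧ c t = c s * expMap Q v := by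
    intro s t hc hst hl
    obtain ⟨a, ha⟩ := hc.isUnit s (left_mem_Icc.2 hst)
    obtain ⟨v, hv, hv'⟩ := hb.exists_expMap_eq hlog (hc.const_mul (a⁻¹).isUnit) hst
      (by rw [← ha]; simp) hl
    exact ⟨v, hv, by rw [hv', ← ha]; simp⟩
  induction N with
  | zero =>
    intro s t hc hst hl
    have hl0 : 0 ≤ ∫ τ in s..t, √(b (u τ) (u τ)) :=
      intervalIntegral.integral_nonneg hst fun _ _ => Real.sqrt_nonneg _
    simp only [Nat.cast_zero, zero_mul] at hl
    obtain ⟨v, hv, hv'⟩ := single hc hst (hl.trans hr)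
    have : v = 0 := hb.eq_zero v (le_antisymm (hv.trans hl) (Real.sqrt_nonneg _))
    exact ⟨Fin.elim0, fun i => i.elim0, by simpa using hl0, by simpa [this] using hv'⟩
  | succ N ih =>
    intro s t hc hst hl
    obtain ⟨τ, hτ, h1, h2⟩ : ∃ τ ∈ Icc s t, ∫ τ in s..τ, √(b (u τ) (u τ)) ≤ r ∧
        ∫ τ in τ..t, √(b (u τ) (u τ)) ≤ N * r := by
      -- A piece of length `r` is cut off, or the whole curve if it is shorter; in that case the
      -- remainder is degenerate.
      rcases le_total (∫ τ in s..t, √(b (u τ) (u τ))) r with hle | hle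
      · exact ⟨t, right_mem_Icc.2 hst, hle, by simp; positivity⟩
      · have hcont : ContinuousOn (fun τ => ∫ τ in s..τ, √(b (u τ) (u τ))) (Icc s t) := by
          rw [← uIcc_of_le hst]
          exact intervalIntegral.continuousOn_primitive_interval
            (by rw [uIcc_of_le hst]; exact hc.integrableOn)
        obtain ⟨τ, hτ, hτr⟩ := intermediate_value_Icc hst hcont
          (show r ∈ Icc _ _ from ⟨by simpa using hr, hle⟩)
        refine ⟨τ, hτ, le_of_eq hτr, ?_⟩
        have h3 := intervalIntegral.integral_add_adjacent_intervals
          ((hc.mono le_rfl hτ.2).intervalIntegrable hτ.1)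
          ((hc.mono hτ.1 le_rfl).intervalIntegrable hτ.2)
        simp only at hτr
        push_cast at hl
        linarith
    obtain ⟨v₀, hv₀, hv₀'⟩ := single (hc.mono le_rfl hτ.2) hτ.1 h1
    obtain ⟨v, hv, hvsum, hv'⟩ := ih (hc.mono hτ.1 le_rfl) hτ.2 h2
    refine ⟨Fin.cons v₀ v, Fin.cases (by simpa using hv₀.trans h1) (by simpa using hv), ?_, ?_⟩
    · rw [← intervalIntegral.integral_add_adjacent_intervals
          ((hc.mono le_rfl hτ.2).intervalIntegrable hτ.1)
          ((hc.mono hτ.1 le_rfl).intervalIntegrable hτ.2), Fin.sum_univ_succ]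
      simpa using add_le_add hv₀ hvsum
    · rw [hv', hv₀', List.ofFn_succ]
      simp [mul_assoc]

end IsGeodesicForm

/-! ### The submonoid generated by the exponential map -/

/-- A continuous one-parameter semigroup lies in the submonoid generated by any neighbourhood of
the identity. -/
theorem mem_closure_of_one_parameter {M : Type*} [Monoid M] [TopologicalSpace M] {U : Set M}
    (hU : U ∈ 𝓝 1) {γ : ℝ → M} (hγ : ContinuousAt γ 0) (h0 : γ 0 = 1)
    (hadd : ∀ s t, γ (s + t) = γ s * γ t) (t : ℝ) : γ t ∈ Submonoid.closure U := by
  have hpow : ∀ (s : ℝ) (N : ℕ), γ (N * s) = γ s ^ N := fun s N => by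
    induction N with
    | zero => simp [h0]
    | succ N ih => rw [pow_succ, ← ih, ← hadd]; push_cast; ring_nf
  have hlim : Tendsto (fun N : ℕ => t / ((N : ℝ) + 1)) atTop (𝓝 0) :=
    tendsto_const_div_atTop_nhds_zero_nat t |>.comp (tendsto_add_atTop_nat 1) |>.congr
      fun N => by simp
  obtain ⟨N, hN⟩ := (hlim.eventually (hγ.preimage_mem_nhds (by rwa [h0]))).exists
  have h1 : t = ((N + 1 : ℕ) : ℝ) * (t / ((N : ℝ) + 1)) := by
    push_cast; field_simp
  rw [h1, hpow]
  exact pow_mem (Submonoid.subset_closure hN) _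

variable [CompleteSpace 𝔸]

theorem range_mem_nhds_one {f : 𝔸 → 𝔸} (hf : HasStrictFDerivAt f (ContinuousLinearMap.id ℝ 𝔸) 0)
    (h0 : f 0 = 1) : range f ∈ 𝓝 1 := by
  have h : map f (𝓝 0) = 𝓝 (f 0) :=
    HasStrictFDerivAt.map_nhds_eq_of_equiv (f' := ContinuousLinearEquiv.refl ℝ 𝔸) hf
  rw [h0] at h
  rw [← h]
  exact Filter.mem_map.2 (Filter.univ_mem' fun x => mem_range_self x)

theorem range_exp_mem_nhds : range (exp : 𝔸 → 𝔸) ∈ 𝓝 1 :=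
  range_mem_nhds_one hasStrictFDerivAt_exp_zero exp_zero

/-- The range of `expMap Q` is a neighbourhood of `1`, and the one-parameter group through `exp x`
lies in the submonoid generated by any such neighbourhood. -/
theorem closure_range_exp_le (Q : 𝔸 →L[ℝ] 𝔸) :
    Submonoid.closure (range (exp : 𝔸 → 𝔸)) ≤ Submonoid.closure (range (expMap Q)) := by
  rw [Submonoid.closure_le]
  rintro _ ⟨x, rfl⟩
  let _ := NormedAlgebra.restrictScalars ℚ ℝ 𝔸
  have := mem_closure_of_one_parameter
    (range_mem_nhds_one (hasStrictFDerivAt_expMap_zero Q) (expMap_zero Q))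
    (γ := fun t : ℝ => exp (t • x)) (hasDerivAt_exp_smul_const x (0 : ℝ)).continuousAt (by simp)
    (fun s t => by
      rw [add_smul, exp_add_of_commute]
      exact ((Commute.refl x).smul_left s).smul_right t) 1
  simpa using this

end BanachAlgebra

open scoped Matrix.Norms.Operator

variable {n : ℕ}

/-! ### The isotropic inner product -/

theorem isoInner_eq (μ μc κ : ℝ) (M N : Matrix (Fin n) (Fin n) ℝ) :
    isoInner μ μc κ M N = (μ + μc) / 2 * (Mᵀ * N).trace + (μ - μc) / 2 * (M * N).trace
      + (κ - μ) / n * (M.trace * N.trace) := by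
  have h1 : (M * Nᵀ).trace = (Mᵀ * N).trace := by
    rw [← Matrix.trace_transpose, Matrix.transpose_mul, Matrix.transpose_transpose,
      Matrix.trace_mul_comm]
  have h2 : (Mᵀ * Nᵀ).trace = (M * N).trace := by
    rw [← Matrix.trace_transpose, Matrix.transpose_mul, Matrix.transpose_transpose,
      Matrix.transpose_transpose, Matrix.trace_mul_comm]
  rcases Nat.eq_zero_or_pos n with rfl | hn
  · simp [isoInner, canonicalInner, Matrix.trace]
  have hn' : (n : ℝ) ≠ 0 := by positivity
  simp only [isoInner, canonicalInner, dev, symPart, skewPart, Matrix.transpose_sub,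
    Matrix.transpose_smul, Matrix.transpose_add, Matrix.transpose_transpose, Matrix.transpose_one,
    Matrix.mul_sub, Matrix.sub_mul, Matrix.mul_add, Matrix.add_mul, Matrix.smul_mul,
    Matrix.mul_smul, Matrix.mul_one, Matrix.one_mul, Matrix.trace_sub, Matrix.trace_add,
    Matrix.trace_smul, Matrix.trace_one, Matrix.trace_transpose, smul_eq_mul, h1, h2,
    Fintype.card_fin]
  field_simp
  ring

theorem isoInner_comm (μ μc κ : ℝ) (M N : Matrix (Fin n) (Fin n) ℝ) :
    isoInner μ μc κ M N = isoInner μ μc κ N M := by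
  have h1 : (Nᵀ * M).trace = (Mᵀ * N).trace := by
    rw [← Matrix.trace_transpose, Matrix.transpose_mul, Matrix.transpose_transpose]
  rw [isoInner_eq, isoInner_eq, h1, Matrix.trace_mul_comm N M, mul_comm N.trace]

/-- The isotropic inner product as a continuous bilinear map. -/
def isoBilin (n : ℕ) (μ μc κ : ℝ) :
    Matrix (Fin n) (Fin n) ℝ →L[ℝ] Matrix (Fin n) (Fin n) ℝ →L[ℝ] ℝ :=
  LinearMap.toContinuousLinearMap
    ((LinearMap.toContinuousLinearMap (𝕜 := ℝ) (E := Matrix (Fin n) (Fin n) ℝ)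
      (F' := ℝ)).toLinearMap ∘ₗ
      LinearMap.mk₂ ℝ (isoInner μ μc κ)
        (fun x y z => by simp [isoInner_eq, Matrix.add_mul]; ring)
        (fun c x y => by simp [isoInner_eq]; ring)
        (fun x y z => by simp [isoInner_eq, Matrix.mul_add]; ring)
        (fun c x y => by simp [isoInner_eq]; ring))

@[simp] theorem isoBilin_apply (μ μc κ : ℝ) (M N : Matrix (Fin n) (Fin n) ℝ) :
    isoBilin n μ μc κ M N = isoInner μ μc κ M N := rfl

/-- With all three weights equal to `1` the form is the Frobenius inner product. Its three summands
are nonnegative on the diagonal, so weights can be compared termwise. -/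
theorem isoInner_self_ge {μ μc κ : ℝ} {c : ℝ} (h1 : c ≤ μ) (h2 : c ≤ μc) (h3 : c ≤ κ)
    (M : Matrix (Fin n) (Fin n) ℝ) :
    c * ∑ i, ∑ j, M i j ^ 2 ≤ isoInner μ μc κ M M := by
  have hsq : ∀ N : Matrix (Fin n) (Fin n) ℝ, 0 ≤ canonicalInner N N := fun N => by
    simp only [canonicalInner, Matrix.trace, Matrix.diag, Matrix.mul_apply, Matrix.transpose_apply]
    exact Finset.sum_nonneg fun _ _ => Finset.sum_nonneg fun _ _ => mul_self_nonneg _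
  have hcan : ∑ i, ∑ j, M i j ^ 2 = isoInner 1 1 1 M M := by
    rw [isoInner_eq, Finset.sum_comm]
    simp [Matrix.trace, Matrix.mul_apply, sq]
  rw [hcan]
  unfold isoInner
  have := mul_nonneg (sub_nonneg.2 h1) (hsq (dev (symPart M)))
  have := mul_nonneg (sub_nonneg.2 h2) (hsq (skewPart M))
  have := mul_nonneg (sub_nonneg.2 h3) (div_nonneg (mul_self_nonneg M.trace) (Nat.cast_nonneg n))
  have e : ∀ a : ℝ, a / (n : ℝ) * (M.trace * M.trace) = a * (M.trace * M.trace / n) :=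
    fun a => by ring
  rw [e, e]
  nlinarith

theorem isoInner_self_nonneg {μ μc κ : ℝ} (hμ : 0 ≤ μ) (hμc : 0 ≤ μc) (hκ : 0 ≤ κ)
    (M : Matrix (Fin n) (Fin n) ℝ) : 0 ≤ isoInner μ μc κ M M := by
  simpa using isoInner_self_ge hμ hμc hκ M

theorem isoInner_cauchy_schwarz {μ μc κ : ℝ} (hμ : 0 ≤ μ) (hμc : 0 ≤ μc) (hκ : 0 ≤ κ)
    (M N : Matrix (Fin n) (Fin n) ℝ) :
    |isoInner μ μc κ M N| ≤ √(isoInner μ μc κ M M) * √(isoInner μ μc κ N N) := by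
  have h : ∀ t : ℝ, 0 ≤ isoInner μ μc κ M M * (t * t) + 2 * isoInner μ μc κ M N * t
      + isoInner μ μc κ N N := fun t => by
    have := isoInner_self_nonneg hμ hμc hκ (t • M + N)
    rw [← isoBilin_apply] at this
    simp only [map_add, map_smul, _root_.add_apply, _root_.smul_apply,
      isoBilin_apply, smul_eq_mul, isoInner_comm μ μc κ N M] at this
    linarith
  have := discrim_le_zero h
  rw [discrim] at this
  rw [← Real.sqrt_mul (isoInner_self_nonneg hμ hμc hκ M)]
  exact Real.abs_le_sqrt (by linarith)

/-- Invariance of the isotropic inner product under conjugation with orthogonal matrices. -/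
theorem isoInner_conj (μ μc κ : ℝ) {O O' : Matrix (Fin n) (Fin n) ℝ} (hO : Oᵀ = O')
    (h : O * O' = 1) (M N : Matrix (Fin n) (Fin n) ℝ) :
    isoInner μ μc κ (O' * M * O) (O' * N * O) = isoInner μ μc κ M N := by
  have hO' : O'ᵀ = O := by rw [← hO, Matrix.transpose_transpose]
  have key : ∀ X Y : Matrix (Fin n) (Fin n) ℝ, O' * X * O * (O' * Y * O) = O' * (X * Y) * O := by
    intro X Y
    calc _ = O' * X * (O * O') * Y * O := by simp only [mul_assoc]
      _ = _ := by rw [h]; simp only [mul_assoc, mul_one]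
  have tr : ∀ X : Matrix (Fin n) (Fin n) ℝ, (O' * X * O).trace = X.trace := fun X => by
    rw [Matrix.trace_mul_cycle, h, one_mul]
  have ht : (O' * M * O)ᵀ = O' * Mᵀ * O := by
    simp only [Matrix.transpose_mul, hO, hO', mul_assoc]
  simp only [isoInner_eq, ht, key, tr]

/-- The norm of the isotropic inner product. -/
def isoNorm (μ μc κ : ℝ) (M : Matrix (Fin n) (Fin n) ℝ) : ℝ := √(isoInner μ μc κ M M)

theorem continuous_isoInner_self (μ μc κ : ℝ) :
    Continuous fun M : Matrix (Fin n) (Fin n) ℝ => isoInner μ μc κ M M := by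
  have := (isoBilin n μ μc κ).continuous.clm_apply continuous_id
  exact this

theorem continuous_isoNorm (μ μc κ : ℝ) :
    Continuous (isoNorm μ μc κ : Matrix (Fin n) (Fin n) ℝ → ℝ) :=
  (continuous_isoInner_self μ μc κ).sqrt

@[simp] theorem isoNorm_zero (μ μc κ : ℝ) : isoNorm μ μc κ (0 : Matrix (Fin n) (Fin n) ℝ) = 0 := by
  simp [isoNorm, isoInner_eq]

theorem abs_apply_le {μ μc κ : ℝ} {c : ℝ} (hc : 0 < c) (h1 : c ≤ μ) (h2 : c ≤ μc) (h3 : c ≤ κ)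
    (M : Matrix (Fin n) (Fin n) ℝ) (i j : Fin n) : |M i j| ≤ (√c)⁻¹ * isoNorm μ μc κ M := by
  have hsum : M i j ^ 2 ≤ ∑ i, ∑ j, M i j ^ 2 :=
    (Finset.single_le_sum (f := fun j => M i j ^ 2) (fun _ _ => sq_nonneg _)
      (Finset.mem_univ j)).trans
      (Finset.single_le_sum (f := fun i => ∑ j, M i j ^ 2)
        (fun _ _ => Finset.sum_nonneg fun _ _ => sq_nonneg _) (Finset.mem_univ i))
  have h := (mul_le_mul_of_nonneg_left hsum hc.le).trans (isoInner_self_ge h1 h2 h3 M)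
  rw [inv_mul_eq_div, le_div_iff₀ (Real.sqrt_pos.2 hc), mul_comm, ← Real.sqrt_sq_eq_abs,
    ← Real.sqrt_mul hc.le]
  exact Real.sqrt_le_sqrt h

theorem isCompact_isoNorm_le {μ μc κ : ℝ} (hμ : 0 < μ) (hμc : 0 < μc) (hκ : 0 < κ) (r : ℝ) :
    IsCompact {M : Matrix (Fin n) (Fin n) ℝ | isoNorm μ μc κ M ≤ r} := by
  obtain ⟨c, hc, h1, h2, h3⟩ : ∃ c, 0 < c ∧ c ≤ μ ∧ c ≤ μc ∧ c ≤ κ :=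
    ⟨min μ (min μc κ), by positivity, by simp, by simp, by simp⟩
  have hK : IsCompact (Set.pi univ fun _ : Fin n => Set.pi univ fun _ : Fin n =>
      Icc (-((√c)⁻¹ * r)) ((√c)⁻¹ * r)) :=
    isCompact_univ_pi fun _ => isCompact_univ_pi fun _ => isCompact_Icc
  have hcl : IsClosed {M : Matrix (Fin n) (Fin n) ℝ | isoNorm μ μc κ M ≤ r} :=
    isClosed_le (continuous_isoNorm _ _ _) continuous_const
  refine hK.of_isClosed_subset hcl fun M hM i _ j _ => ?_
  exact abs_le.1 ((abs_apply_le hc h1 h2 h3 M i j).trans (by gcongr; exact hM))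

theorem isoNorm_eq_zero {μ μc κ : ℝ} (hμ : 0 < μ) (hμc : 0 < μc) (hκ : 0 < κ)
    {M : Matrix (Fin n) (Fin n) ℝ} (h : isoNorm μ μc κ M = 0) : M = 0 := by
  obtain ⟨c, hc, h1, h2, h3⟩ : ∃ c, 0 < c ∧ c ≤ μ ∧ c ≤ μc ∧ c ≤ κ :=
    ⟨min μ (min μc κ), by positivity, by simp, by simp, by simp⟩
  ext i j
  simpa [h] using abs_apply_le hc h1 h2 h3 M i j

/-! ### The isotropic metric -/

/-- The skew symmetric generator `δ (x - xᵀ)` of the rotational factor of a geodesic. -/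
def skewGen (n : ℕ) (δ : ℝ) : Matrix (Fin n) (Fin n) ℝ →L[ℝ] Matrix (Fin n) (Fin n) ℝ :=
  LinearMap.toContinuousLinearMap
    (δ • (LinearMap.id - (Matrix.transposeLinearEquiv (Fin n) (Fin n) ℝ ℝ).toLinearMap))

theorem skewGen_apply (δ : ℝ) (x : Matrix (Fin n) (Fin n) ℝ) :
    skewGen n δ x = δ • (x - xᵀ) := rfl

theorem transpose_skewGen (δ : ℝ) (x : Matrix (Fin n) (Fin n) ℝ) :
    (skewGen n δ x)ᵀ = -skewGen n δ x := by
  simp [skewGen_apply, ← smul_neg]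

/-- The Euler-Arnold equation of the isotropic metric. -/
theorem isoInner_skewGen {μ μc κ : ℝ} (hμ : μ ≠ 0) (v y : Matrix (Fin n) (Fin n) ℝ) :
    isoInner μ μc κ (v * skewGen n ((μ + μc) / (2 * μ)) v
      - skewGen n ((μ + μc) / (2 * μ)) v * v) y + isoInner μ μc κ v (y * v - v * y) = 0 := by
  -- The commutator is `δ S` with `S = vᵀ v - v vᵀ` symmetric and trace-free, so the first term is
  -- `μ δ tr(S y)`. The second is `-(μ + μc) / 2 * tr(S y)`, which determines `δ`.
  have e1 : v * skewGen n ((μ + μc) / (2 * μ)) v - skewGen n ((μ + μc) / (2 * μ)) v * v =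
      ((μ + μc) / (2 * μ)) • (vᵀ * v - v * vᵀ) := by
    simp only [skewGen_apply, mul_smul_comm, smul_mul_assoc, ← smul_sub]
    congr 1
    noncomm_ring
  have t1 : (vᵀ * (y * v)).trace = (v * (vᵀ * y)).trace := by
    rw [← mul_assoc, Matrix.trace_mul_comm]
  have t2 : (v * (y * v)).trace = (v * (v * y)).trace := by
    rw [← mul_assoc, Matrix.trace_mul_comm]
  have t3 : (y * v).trace = (v * y).trace := Matrix.trace_mul_comm _ _
  have t4 : (v * vᵀ).trace = (vᵀ * v).trace := Matrix.trace_mul_comm _ _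
  rw [e1, isoInner_eq, isoInner_eq]
  simp only [Matrix.transpose_smul, Matrix.transpose_sub, Matrix.transpose_mul,
    Matrix.transpose_transpose, Matrix.smul_mul, Matrix.sub_mul, Matrix.trace_smul,
    Matrix.trace_sub, Matrix.mul_sub, t1, t2, t3, t4, smul_eq_mul, sub_self, mul_zero, zero_mul,
    add_zero, mul_assoc]
  field_simp
  ring

theorem isoInner_conj_exp_skewGen (μ μc κ δ : ℝ) (v y z : Matrix (Fin n) (Fin n) ℝ) :
    isoInner μ μc κ (exp (-skewGen n δ v) * y * exp (skewGen n δ v))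
      (exp (-skewGen n δ v) * z * exp (skewGen n δ v)) = isoInner μ μc κ y z := by
  refine isoInner_conj μ μc κ (by rw [← Matrix.exp_transpose, transpose_skewGen]) ?_ y z
  rw [← Matrix.exp_add_of_commute _ _ (Commute.refl (skewGen n δ v)).neg_right, add_neg_cancel,
    exp_zero]

theorem isGeodesicForm_isoBilin {μ μc κ : ℝ} (hμ : 0 < μ) (hμc : 0 < μc) (hκ : 0 < κ) :
    IsGeodesicForm (skewGen n ((μ + μc) / (2 * μ))) (isoBilin n μ μc κ) where
  symm := isoInner_comm μ μc κ
  nonneg := isoInner_self_nonneg hμ.le hμc.le hκ.le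
  cauchy_schwarz := isoInner_cauchy_schwarz hμ.le hμc.le hκ.le
  conj := isoInner_conj_exp_skewGen μ μc κ _
  geodesic := isoInner_skewGen hμ.ne'
  isCompact_le := isCompact_isoNorm_le hμ hμc hκ
  eq_zero _ := isoNorm_eq_zero hμ hμc hκ

/-! ### Generation of the identity component -/

/-- `exp y` is the square of the invertible matrix `exp (y / 2)`. -/
theorem det_pos_of_mem_closure_exp {M : Matrix (Fin n) (Fin n) ℝ}
    (hM : M ∈ Submonoid.closure (range (exp : Matrix (Fin n) (Fin n) ℝ → _))) : 0 < M.det := by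
  induction hM using Submonoid.closure_induction with
  | mem x hx =>
    obtain ⟨y, rfl⟩ := hx
    have hy : (1 / 2 : ℝ) • y + (1 / 2 : ℝ) • y = y := by rw [← add_smul]; norm_num
    rw [← hy, Matrix.exp_add_of_commute _ _ (Commute.refl _), Matrix.det_mul]
    have hu : IsUnit (exp ((1 / 2 : ℝ) • y)) := Matrix.isUnit_exp _
    exact mul_self_pos.2 ((Matrix.isUnit_iff_isUnit_det _).1 hu).ne_zero
  | one => simp
  | mul x y _ _ hx hy => rw [Matrix.det_mul]; exact mul_pos hx hy

/-- The reflection in the coordinate `i`. -/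
def coordReflection (i : Fin n) : Matrix (Fin n) (Fin n) ℝ :=
  Matrix.diagonal fun k => if k = i then -1 else 1

theorem coordReflection_mul_self (i : Fin n) : coordReflection i * coordReflection i = 1 := by
  rw [coordReflection, Matrix.diagonal_mul_diagonal, ← Matrix.diagonal_one]
  congr 1
  ext k
  split_ifs <;> simp

theorem det_coordReflection (i : Fin n) : (coordReflection i).det = -1 := by
  rw [coordReflection, Matrix.det_diagonal, Finset.prod_ite_eq' Finset.univ i]
  simp

/-- For fixed `i ≠ j`, transvections form a continuous one-parameter group in `c`. -/
theorem transvection_mem_closure_exp {i j : Fin n} (hij : i ≠ j) (c : ℝ) :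
    Matrix.transvection i j c ∈
      Submonoid.closure (range (exp : Matrix (Fin n) (Fin n) ℝ → _)) := by
  refine mem_closure_of_one_parameter range_exp_mem_nhds (γ := Matrix.transvection i j) ?_
    (Matrix.transvection_zero i j)
    (fun s t => (Matrix.transvection_mul_transvection_same i j hij s t).symm) c
  have : Continuous fun c : ℝ => (1 : Matrix (Fin n) (Fin n) ℝ) + c • Matrix.single i j 1 := by
    fun_prop
  refine this.continuousAt.congr (Eventually.of_forall fun c => ?_)
  simp [Matrix.transvection, Matrix.smul_single]

/-- The product of two coordinate reflections is the square of a product of transvections. -/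
theorem coordReflection_mul_coordReflection {i j : Fin n} (hij : i ≠ j) :
    coordReflection i * coordReflection j =
      (Matrix.transvection i j 1 * Matrix.transvection j i (-1) * Matrix.transvection i j 1) ^ 2 := by
  set E : Matrix (Fin n) (Fin n) ℝ := Matrix.single i j 1 with hE
  set G : Matrix (Fin n) (Fin n) ℝ := Matrix.single j i 1 with hG
  have h1 : E * E = 0 := by simp [hE, hij.symm]
  have h2 : G * G = 0 := by simp [hG, hij]
  have h3 : E * (G * E) = E := by simp [hE, hG]
  have h4 : G * (E * G) = G := by simp [hE, hG]
  have h1' : ∀ x, E * (E * x) = 0 := fun x => by rw [← mul_assoc, h1, zero_mul]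
  have h2' : ∀ x, G * (G * x) = 0 := fun x => by rw [← mul_assoc, h2, zero_mul]
  -- The product of the three transvections is a quarter turn in the `(i, j)` plane; its square is
  -- `-1` on that plane.
  have hW : Matrix.transvection i j 1 * Matrix.transvection j i (-1) * Matrix.transvection i j 1
      = 1 + E - G - E * G - G * E := by
    have hT : Matrix.transvection j i (-1) = 1 - G := by
      rw [Matrix.transvection, sub_eq_add_neg, hG, ← Matrix.single_neg]
    rw [hT, Matrix.transvection, ← hE]
    simp only [mul_add, add_mul, mul_sub, sub_mul, mul_assoc, mul_one, one_mul, h1, h3]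
    abel
  have hW2 : (1 + E - G - E * G - G * E) ^ 2 = 1 - (2 : ℝ) • (E * G + G * E) := by
    simp only [sq, mul_add, add_mul, mul_sub, sub_mul, mul_assoc, mul_one, one_mul, h1, h2, h3, h4,
      h1', h2', two_smul, mul_zero]
    abel
  rw [hW, hW2, coordReflection, coordReflection, Matrix.diagonal_mul_diagonal]
  ext k l
  have hEG : E * G = Matrix.single i i 1 := by simp [hE, hG]
  have hGE : G * E = Matrix.single j j 1 := by simp [hE, hG]
  rw [hEG, hGE]
  simp only [Matrix.diagonal_apply, Matrix.sub_apply, Matrix.one_apply, Matrix.smul_apply,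
    Matrix.add_apply, Matrix.single_apply, smul_eq_mul]
  grind

/-- Every matrix with positive determinant is a product of exponentials. -/
theorem mem_closure_exp_of_det_pos {M : Matrix (Fin n) (Fin n) ℝ} (hM : 0 < M.det) :
    M ∈ Submonoid.closure (range (exp : Matrix (Fin n) (Fin n) ℝ → _)) := by
  rcases Nat.eq_zero_or_pos n with rfl | hn
  · rw [Subsingleton.elim M 1]; exact one_mem _
  set H := Submonoid.closure (range (exp : Matrix (Fin n) (Fin n) ℝ → _)) with hH
  let i₀ : Fin n := ⟨0, hn⟩
  have hσσ := coordReflection_mul_self i₀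
  have hconj : ∀ h ∈ H, coordReflection i₀ * h * coordReflection i₀ ∈ H := by
    intro h hh
    induction hh using Submonoid.closure_induction with
    | mem x hx =>
      obtain ⟨y, rfl⟩ := hx
      have hinv : (coordReflection i₀)⁻¹ = coordReflection i₀ := Matrix.inv_eq_left_inv hσσ
      have hu : IsUnit (coordReflection i₀) := IsUnit.of_mul_eq_one _ hσσ
      have := Matrix.exp_conj _ y hu
      rw [hinv] at this
      rw [← this]
      exact Submonoid.subset_closure (mem_range_self _)
    | one => rw [mul_one, hσσ]; exact one_mem _
    | mul x y _ _ hx hy =>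
      have := mul_mem hx hy
      rwa [show coordReflection i₀ * x * coordReflection i₀ *
        (coordReflection i₀ * y * coordReflection i₀) = coordReflection i₀ * x *
          (coordReflection i₀ * coordReflection i₀) * y * coordReflection i₀ by noncomm_ring,
        hσσ, mul_one, mul_assoc _ x] at this
  -- `P` describes `H ∪ H σ` for the reflection `σ`. It is closed under products since `σ² = 1` and
  -- conjugation by `σ` preserves `H`.
  let P : Matrix (Fin n) (Fin n) ℝ → Prop := fun N => N ∈ H ∨ ∃ h ∈ H, N = h * coordReflection i₀
  have hmul : ∀ N N', P N → P N' → P (N * N') := by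
    rintro N N' (h | ⟨h, hh, rfl⟩) (h' | ⟨h', hh', rfl⟩)
    · exact Or.inl (mul_mem h h')
    · exact Or.inr ⟨N * h', mul_mem h hh', (mul_assoc _ _ _).symm⟩
    · refine Or.inr ⟨_, mul_mem hh (hconj _ h'), ?_⟩
      simp only [mul_assoc, hσσ, mul_one]
    · refine Or.inl ?_
      have := mul_mem hh (hconj _ hh')
      simpa only [mul_assoc] using this
  have hrefl : ∀ i, P (coordReflection i) := by
    intro i
    by_cases hi : i = i₀
    · exact Or.inr ⟨1, one_mem _, by rw [hi, one_mul]⟩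
    · refine Or.inr ⟨coordReflection i * coordReflection i₀, ?_, by rw [mul_assoc, hσσ, mul_one]⟩
      rw [coordReflection_mul_coordReflection hi]
      exact pow_mem (mul_mem (mul_mem (transvection_mem_closure_exp hi _)
        (transvection_mem_closure_exp (Ne.symm hi) _)) (transvection_mem_closure_exp hi _)) _
  have hsign : ∀ S : Finset (Fin n), P (Matrix.diagonal fun k => if k ∈ S then -1 else 1) := by
    intro S
    induction S using Finset.induction_on with
    | empty => exact Or.inl (by simp)
    | insert a S ha ih =>
      have h := hmul _ _ (hrefl a) ih
      rw [coordReflection, Matrix.diagonal_mul_diagonal] at h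
      refine (congrArg (fun d => P (Matrix.diagonal d)) (funext fun k => ?_)).mpr h
      by_cases hk : k = a
      · simp [hk, ha]
      · simp [hk]
  have hPM : P M := by
    refine Matrix.diagonal_transvection_induction_of_det_ne_zero P M hM.ne' (fun D hD => ?_)
      (fun t => Or.inl (transvection_mem_closure_exp t.hij t.c)) (fun N N' _ _ => hmul N N')
    have hD0 : ∀ k, D k ≠ 0 := fun k hk => hD (by
      rw [Matrix.det_diagonal]; exact Finset.prod_eq_zero (Finset.mem_univ k) hk)
    have habs : Matrix.diagonal (fun k => |D k|) ∈ H := by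
      refine Submonoid.subset_closure ⟨Matrix.diagonal fun k => Real.log |D k|, ?_⟩
      rw [Matrix.exp_diagonal]
      congr 1
      ext k
      rw [Pi.coe_exp, ← Real.exp_eq_exp_ℝ, Real.exp_log (abs_pos.2 (hD0 k))]
    -- A diagonal matrix factors into its absolute values, which have a diagonal logarithm, and its
    -- signs.
    have h := hmul _ _ (Or.inl habs) (hsign (Finset.univ.filter fun k => D k < 0))
    rw [Matrix.diagonal_mul_diagonal] at h
    convert h using 2
    ext k
    by_cases hk : D k < 0
    · simp [hk, abs_of_neg hk]
    · simp [hk, abs_of_nonneg (not_lt.1 hk)]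
  rcases hPM with h | ⟨h, hh, rfl⟩
  · exact h
  · rw [Matrix.det_mul, det_coordReflection] at hM
    linarith [det_pos_of_mem_closure_exp hh]

/-- Every matrix with positive determinant is a product of values of the geodesic exponential
map. -/
theorem exists_list_expMap_prod_eq
    (Q : Matrix (Fin n) (Fin n) ℝ →L[ℝ] Matrix (Fin n) (Fin n) ℝ)
    {M : Matrix (Fin n) (Fin n) ℝ} (hM : 0 < M.det) :
    ∃ l : List (Matrix (Fin n) (Fin n) ℝ), (l.map (expMap Q)).prod = M := by
  have hle : Submonoid.closure (range (exp : Matrix (Fin n) (Fin n) ℝ → _)) ≤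
      Submonoid.closure (range (expMap Q)) := closure_range_exp_le Q
  obtain ⟨l, hl, hlM⟩ := Submonoid.exists_list_of_mem_closure (hle (mem_closure_exp_of_det_pos hM))
  choose! f hf using hl
  refine ⟨l.map f, ?_⟩
  rw [List.map_map, List.map_congr_left (f := _ ∘ f) (g := id) hf, List.map_id, hlM]

/-! ### Admissible curves -/

/-- The right derivative of a curve, translated to the identity. -/
def rightVelocity (X : ℝ → Matrix (Fin n) (Fin n) ℝ) (t : ℝ) : Matrix (Fin n) (Fin n) ℝ :=
  (X t)⁻¹ * derivWithin X (Ioi t) t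

/-- Right derivatives exist at the left end point of a piece too, so consecutive pieces can be
glued. They agree with `deriv` in the interior, which suffices for integrals. -/
theorem IsRegularC1On.hasBodyVelocity (μ μc κ : ℝ) {X : ℝ → Matrix (Fin n) (Fin n) ℝ} {a b : ℝ}
    (hX : IsRegularC1On X a b) (hdet : ∀ t ∈ Icc a b, (X t).det ≠ 0) :
    HasBodyVelocity (isoBilin n μ μc κ) X (rightVelocity X) a b ∧
      ∀ t ∈ Ioo a b, deriv X t = derivWithin X (Ioi t) t := by
  obtain ⟨X', hX'c, hX'⟩ := hX
  have hcont : ContinuousOn X (Icc a b) := fun t ht => (hX' t ht).1.continuousWithinAt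
  have hright : ∀ t ∈ Ico a b, HasDerivWithinAt X (X' t) (Ioi t) t := fun t ht =>
    (hX' t (Ico_subset_Icc_self ht)).1.mono_of_mem_nhdsWithin (Icc_mem_nhdsGT_of_mem ht)
  have hderiv : ∀ t ∈ Ico a b, derivWithin X (Ioi t) t = X' t := fun t ht =>
    (hright t ht).derivWithin (uniqueDiffWithinAt_Ioi t)
  refine ⟨⟨hcont, fun t ht => (Matrix.isUnit_iff_isUnit_det _).2 (hdet t ht).isUnit, ?_, ?_⟩, ?_⟩
  · intro t ht
    refine (hright t ht).congr_deriv ?_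
    rw [rightVelocity, hderiv t ht, ← mul_assoc,
      Matrix.mul_nonsing_inv _ (hdet t (Ico_subset_Icc_self ht)).isUnit, one_mul]
  · have hinv : ContinuousOn (fun t => (X t)⁻¹) (Icc a b) := by
      have h1 : ContinuousOn (fun t => (X t).det⁻¹ • (X t).adjugate) (Icc a b) :=
        ((continuous_id.matrix_det.comp_continuousOn hcont).inv₀ hdet).smul
          (continuous_id.matrix_adjugate.comp_continuousOn hcont)
      refine h1.congr fun t _ => ?_
      simp [Matrix.inv_def, Ring.inverse_eq_inv']
    have h2 : ContinuousOn (fun t => isoNorm μ μc κ ((X t)⁻¹ * X' t)) (Icc a b) :=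
      (continuous_isoNorm μ μc κ).comp_continuousOn (hinv.mul hX'c)
    have h3 := h2.integrableOn_compact isCompact_Icc (μ := volume)
    rw [integrableOn_Icc_iff_integrableOn_Ico] at h3 ⊢
    refine h3.congr_fun (fun t ht => ?_) measurableSet_Ico
    simp only [rightVelocity, hderiv t ht]
    rfl
  · intro t ht
    rw [hderiv t (Ioo_subset_Ico_self ht)]
    exact ((hX' t (Ioo_subset_Icc_self ht)).1.hasDerivAt (Icc_mem_nhds ht.1 ht.2)).deriv

namespace AdmissibleCurve

variable {A B : Matrix (Fin n) (Fin n) ℝ}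

theorem hasBodyVelocity (μ μc κ : ℝ) (X : AdmissibleCurve A B) :
    X.a ≤ X.b ∧ HasBodyVelocity (isoBilin n μ μc κ) X.toFun (rightVelocity X.toFun) X.a X.b ∧
      ∀ᵐ t, t ∈ Ioc X.a X.b → deriv X.toFun t = derivWithin X.toFun (Ioi t) t := by
  obtain ⟨hcont, hdet, m, p, hp, ha, hb, hpiece⟩ := X.piecewise
  have hmem : ∀ k, p k ∈ Icc X.a X.b := fun k =>
    ⟨ha ▸ hp.monotone (Fin.zero_le k), hb ▸ hp.monotone (Fin.le_last k)⟩
  have key : ∀ k : Fin (m + 2), X.a ≤ p k ∧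
      HasBodyVelocity (isoBilin n μ μc κ) X.toFun (rightVelocity X.toFun) X.a (p k) ∧
      ∀ᵐ t, t ∈ Ioc X.a (p k) → deriv X.toFun t = derivWithin X.toFun (Ioi t) t := by
    intro k
    induction k using Fin.induction with
    | zero =>
      rw [ha]
      refine ⟨le_rfl, ⟨by simp, ?_, by simp, by simp⟩, by simp⟩
      intro t ht
      rw [Icc_self, mem_singleton_iff] at ht
      rw [ht, Matrix.isUnit_iff_isUnit_det]
      exact (hdet X.a (ha ▸ hmem 0)).isUnit
    | succ k ih =>
      obtain ⟨h1, h2, h3⟩ := ih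
      have hlt : p k.castSucc < p k.succ := hp Fin.castSucc_lt_succ
      obtain ⟨h4, h5⟩ := (hpiece k).hasBodyVelocity μ μc κ
        fun t ht => hdet t (Icc_subset_Icc (hmem _).1 (hmem _).2 ht)
      refine ⟨h1.trans hlt.le, h2.trans h4 h1 hlt.le, ?_⟩
      have h6 : ∀ᵐ t : ℝ, t ≠ p k.succ := by simp [ae_iff]
      filter_upwards [h3, h6] with t ht ht' htm
      rcases le_or_gt t (p k.castSucc) with hle | hgt
      · exact ht ⟨htm.1, hle⟩
      · exact h5 t ⟨hgt, lt_of_le_of_ne htm.2 ht'⟩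
  simpa [hb] using key (Fin.last _)

theorem curveLength_eq (μ μc κ : ℝ) (X : AdmissibleCurve A B) :
    curveLength (isoMetric μ μc κ) X = ∫ t in X.a..X.b,
      √(isoBilin n μ μc κ (rightVelocity X.toFun t) (rightVelocity X.toFun t)) := by
  obtain ⟨h1, -, h3⟩ := X.hasBodyVelocity μ μc κ
  refine intervalIntegral.integral_congr_ae ?_
  rw [uIoc_of_le h1]
  filter_upwards [h3] with t ht htm
  rw [ht htm]
  rfl

theorem intervalIntegrable_speed (μ μc κ : ℝ) (X : AdmissibleCurve A B) :
    IntervalIntegrable (fun t => √(isoMetric μ μc κ (X.toFun t) (deriv X.toFun t)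
      (deriv X.toFun t))) volume X.a X.b := by
  obtain ⟨h1, h2, h3⟩ := X.hasBodyVelocity μ μc κ
  refine (h2.intervalIntegrable h1).congr_ae ?_
  rw [uIoc_of_le h1, Filter.EventuallyEq, ae_restrict_iff' measurableSet_Ioc]
  filter_upwards [h3] with t ht htm
  rw [ht htm]
  rfl

end AdmissibleCurve

/-! ### Broken geodesics -/

section BrokenGeodesic

variable {μ μc κ : ℝ} {Q : Matrix (Fin n) (Fin n) ℝ →L[ℝ] Matrix (Fin n) (Fin n) ℝ}

/-- The geodesic starting at time `s` in `A` with initial velocity `A * v`. -/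
def geodesicFrom (Q : Matrix (Fin n) (Fin n) ℝ →L[ℝ] Matrix (Fin n) (Fin n) ℝ)
    (A v : Matrix (Fin n) (Fin n) ℝ) (s t : ℝ) : Matrix (Fin n) (Fin n) ℝ :=
  A * expMap Q ((t - s) • v)

theorem hasDerivAt_geodesicFrom (A v : Matrix (Fin n) (Fin n) ℝ) (s t : ℝ) :
    HasDerivAt (geodesicFrom Q A v s) (geodesicFrom Q A v s t * bodyCurve Q v (t - s)) t := by
  have h1 := ((hasDerivAt_expMap_smul Q v (t - s)).comp_sub_const t s).const_mul A
  refine h1.congr_deriv ?_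
  rw [geodesicFrom, mul_assoc]

theorem deriv_geodesicFrom (A v : Matrix (Fin n) (Fin n) ℝ) (s t : ℝ) :
    deriv (geodesicFrom Q A v s) t = geodesicFrom Q A v s t * bodyCurve Q v (t - s) :=
  (hasDerivAt_geodesicFrom A v s t).deriv

@[simp] theorem geodesicFrom_self (A v : Matrix (Fin n) (Fin n) ℝ) (s : ℝ) :
    geodesicFrom Q A v s s = A := by
  have h : expMap Q (0 : Matrix (Fin n) (Fin n) ℝ) = 1 := expMap_zero Q
  rw [geodesicFrom, sub_self, zero_smul, h, mul_one]

theorem continuous_geodesicFrom (A v : Matrix (Fin n) (Fin n) ℝ) (s : ℝ) :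
    Continuous (geodesicFrom Q A v s) :=
  continuous_iff_continuousAt.2 fun t => (hasDerivAt_geodesicFrom A v s t).continuousAt

theorem det_expMap_ne_zero (x : Matrix (Fin n) (Fin n) ℝ) : (expMap Q x).det ≠ 0 :=
  ((Matrix.isUnit_iff_isUnit_det _).1 (isUnit_expMap Q x)).ne_zero

theorem det_geodesicFrom_ne_zero {A : Matrix (Fin n) (Fin n) ℝ} (hA : A.det ≠ 0)
    (v : Matrix (Fin n) (Fin n) ℝ) (s t : ℝ) : (geodesicFrom Q A v s t).det ≠ 0 := by
  rw [geodesicFrom, Matrix.det_mul]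
  exact mul_ne_zero hA (det_expMap_ne_zero _)

/-- The velocity is an invertible matrix times `bodyCurve Q v (t - s)`, which keeps the norm of `v`
and so cannot vanish. -/
theorem isRegularC1On_geodesicFrom (hQ : IsGeodesicForm Q (isoBilin n μ μc κ))
    {A v : Matrix (Fin n) (Fin n) ℝ} (hA : A.det ≠ 0) (hv : v ≠ 0) (s a b : ℝ) :
    IsRegularC1On (geodesicFrom Q A v s) a b := by
  refine ⟨fun t => geodesicFrom Q A v s t * bodyCurve Q v (t - s), ?_, fun t _ =>
    ⟨(hasDerivAt_geodesicFrom A v s t).hasDerivWithinAt, fun h => hv ?_⟩⟩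
  · exact ((continuous_geodesicFrom A v s).mul
      ((continuous_bodyCurve Q v).comp (continuous_id.sub continuous_const))).continuousOn
  · have h1 : bodyCurve Q v (t - s) = 0 :=
      ((Matrix.isUnit_iff_isUnit_det _).2
        (det_geodesicFrom_ne_zero hA v s t).isUnit).mul_right_eq_zero.1 h
    apply hQ.eq_zero
    have h2 := hQ.bodyCurve_self v (t - s)
    rw [h1] at h2
    rw [← h2]
    simp

theorem speed_geodesicFrom (hQ : IsGeodesicForm Q (isoBilin n μ μc κ))
    {A : Matrix (Fin n) (Fin n) ℝ} (hA : A.det ≠ 0) (v : Matrix (Fin n) (Fin n) ℝ) (s t : ℝ) :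
    √(isoMetric μ μc κ (geodesicFrom Q A v s t) (deriv (geodesicFrom Q A v s) t)
      (deriv (geodesicFrom Q A v s) t)) = isoNorm μ μc κ v := by
  have h1 : (geodesicFrom Q A v s t)⁻¹ * deriv (geodesicFrom Q A v s) t =
      bodyCurve Q v (t - s) := by
    rw [deriv_geodesicFrom, ← mul_assoc,
      Matrix.nonsing_inv_mul _ (det_geodesicFrom_ne_zero hA v s t).isUnit, one_mul]
  rw [isoMetric, h1]
  exact congrArg Real.sqrt (hQ.bodyCurve_self v (t - s))

/-- A single geodesic segment is an admissible curve. -/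
theorem exists_admissibleCurve_segment (hQ : IsGeodesicForm Q (isoBilin n μ μc κ))
    {A v : Matrix (Fin n) (Fin n) ℝ} (hA : A.det ≠ 0) (hv : v ≠ 0) :
    ∃ X : AdmissibleCurve A (A * expMap Q v),
      curveLength (isoMetric μ μc κ) X = isoNorm μ μc κ v := by
  refine ⟨⟨0, 1, geodesicFrom Q A v 0, ⟨(continuous_geodesicFrom A v 0).continuousOn,
    fun t _ => det_geodesicFrom_ne_zero hA v 0 t, 0, ![0, 1], ?_, rfl, rfl, fun j =>
      isRegularC1On_geodesicFrom hQ hA hv _ _ _⟩, geodesicFrom_self _ _ _, by simp [geodesicFrom]⟩, ?_⟩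
  · rw [Fin.strictMono_iff_lt_succ]
    intro i
    fin_cases i
    simp
  · simp [curveLength, speed_geodesicFrom hQ hA v]

theorem IsRegularC1On.congr {X Y : ℝ → Matrix (Fin n) (Fin n) ℝ} {a b : ℝ}
    (hX : IsRegularC1On X a b) (h : EqOn Y X (Icc a b)) : IsRegularC1On Y a b := by
  obtain ⟨X', hc, hX'⟩ := hX
  exact ⟨X', hc, fun t ht => ⟨(hX' t ht).1.congr h (h ht), (hX' t ht).2⟩⟩

/-- A geodesic segment can be put in front of an admissible curve. -/
theorem exists_admissibleCurve_cons (hQ : IsGeodesicForm Q (isoBilin n μ μc κ))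
    {A B v : Matrix (Fin n) (Fin n) ℝ} (hA : A.det ≠ 0) (hv : v ≠ 0)
    (X : AdmissibleCurve (A * expMap Q v) B) :
    ∃ Z : AdmissibleCurve A B, curveLength (isoMetric μ μc κ) Z =
      isoNorm μ μc κ v + curveLength (isoMetric μ μc κ) X := by
  -- The segment takes the unit of time before `X.a`, so `X` keeps its parametrisation and the
  -- segment contributes exactly `isoNorm μ μc κ v`.
  set Y := geodesicFrom Q A v (X.a - 1) with hY
  set Z : ℝ → Matrix (Fin n) (Fin n) ℝ := fun t => if t ≤ X.a then Y t else X.toFun t with hZ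
  have hYa : Y X.a = X.toFun X.a := by rw [X.map_left, hY, geodesicFrom]; simp
  have hZY : ∀ t, t ≤ X.a → Z t = Y t := fun t ht => if_pos ht
  have hZX : ∀ t, X.a ≤ t → Z t = X.toFun t := fun t ht => by
    rcases ht.eq_or_lt with rfl | h
    · rw [hZY _ le_rfl, hYa]
    · exact if_neg (not_le.2 h)
  have hab := (X.hasBodyVelocity μ μc κ).1
  obtain ⟨hcont, hdet, m, p, hp, ha, hb, hpiece⟩ := X.piecewise
  have hmem : ∀ k, p k ∈ Icc X.a X.b := fun k =>
    ⟨ha ▸ hp.monotone (Fin.zero_le k), hb ▸ hp.monotone (Fin.le_last k)⟩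
  have hle : X.a - 1 ≤ X.a := by linarith
  have hpw : IsPiecewiseRegularC1 Z (X.a - 1) X.b := by
    refine ⟨?_, ?_, m + 1, Fin.cons (X.a - 1) p, ?_, rfl, ?_, ?_⟩
    · rw [← Icc_union_Icc_eq_Icc hle hab]
      exact ((continuous_geodesicFrom A v (X.a - 1)).continuousOn.congr
        fun t ht => hZY t ht.2).union_of_isClosed (hcont.congr fun t ht => hZX t ht.1)
          isClosed_Icc isClosed_Icc
    · intro t ht
      rcases le_total t X.a with h | h
      · rw [hZY t h]; exact det_geodesicFrom_ne_zero hA v _ t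
      · rw [hZX t h]; exact hdet t ⟨h, ht.2⟩
    · rw [Fin.strictMono_iff_lt_succ]
      refine Fin.cases ?_ fun i => ?_
      · simp [ha]
      · rw [← Fin.succ_castSucc, Fin.cons_succ, Fin.cons_succ]
        exact hp Fin.castSucc_lt_succ
    · rw [← Fin.succ_last, Fin.cons_succ, hb]
    · refine Fin.cases ?_ fun i => ?_
      · rw [Fin.castSucc_zero, Fin.cons_zero, Fin.cons_succ, ha]
        exact (isRegularC1On_geodesicFrom hQ hA hv _ _ _).congr fun t ht => hZY t ht.2
      · rw [← Fin.succ_castSucc, Fin.cons_succ, Fin.cons_succ]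
        exact (hpiece i).congr fun t ht => hZX t ((hmem _).1.trans ht.1)
  let W : AdmissibleCurve A B := ⟨X.a - 1, X.b, Z, hpw, by
    rw [hZY _ hle]; exact geodesicFrom_self _ _ _, by rw [hZX _ hab, X.map_right]⟩
  refine ⟨W, ?_⟩
  have hint := W.intervalIntegrable_speed μ μc κ
  have h1 : IntervalIntegrable (fun t => √(isoMetric μ μc κ (Z t) (deriv Z t) (deriv Z t))) volume
      (X.a - 1) X.a := hint.mono_set (by
    rw [uIcc_of_le hle, uIcc_of_le (hle.trans hab)]; exact Icc_subset_Icc_right hab)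
  have h2 : IntervalIntegrable (fun t => √(isoMetric μ μc κ (Z t) (deriv Z t) (deriv Z t))) volume
      X.a X.b := hint.mono_set (by
    rw [uIcc_of_le hab, uIcc_of_le (hle.trans hab)]; exact Icc_subset_Icc_left hle)
  have h3 : ∀ᵐ t : ℝ, t ≠ X.a := by simp [ae_iff]
  have h4 : ∫ t in (X.a - 1)..X.a, √(isoMetric μ μc κ (Z t) (deriv Z t) (deriv Z t)) =
      isoNorm μ μc κ v := by
    have : ∫ t in (X.a - 1)..X.a, √(isoMetric μ μc κ (Z t) (deriv Z t) (deriv Z t)) =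
        ∫ _ in (X.a - 1)..X.a, isoNorm μ μc κ v := by
      refine intervalIntegral.integral_congr_ae ?_
      rw [uIoc_of_le hle]
      filter_upwards [h3] with t ht htm
      have hlt : t < X.a := lt_of_le_of_ne htm.2 ht
      have he : Z =ᶠ[𝓝 t] Y := Filter.mem_of_superset (Iio_mem_nhds hlt)
        fun x hx => hZY x (le_of_lt hx)
      have hd : deriv Z t = deriv Y t := he.deriv_eq
      rw [hd, hZY t hlt.le]
      exact speed_geodesicFrom hQ hA v _ t
    rw [this]
    simp
  have h5 : ∫ t in X.a..X.b, √(isoMetric μ μc κ (Z t) (deriv Z t) (deriv Z t)) =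
      curveLength (isoMetric μ μc κ) X := by
    refine intervalIntegral.integral_congr_ae ?_
    rw [uIoc_of_le hab]
    refine Eventually.of_forall fun t htm => ?_
    have he : Z =ᶠ[𝓝 t] X.toFun := Filter.mem_of_superset (Ioi_mem_nhds htm.1)
      fun x hx => hZX x (le_of_lt hx)
    have hd : deriv Z t = deriv X.toFun t := he.deriv_eq
    rw [hd, hZX t htm.1.le]
  rw [← h4, ← h5]
  exact (intervalIntegral.integral_add_adjacent_intervals h1 h2).symm

/-- Broken geodesics are admissible curves. -/
theorem exists_admissibleCurve_list (hQ : IsGeodesicForm Q (isoBilin n μ μc κ))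
    (l : List (Matrix (Fin n) (Fin n) ℝ)) : ∀ {A : Matrix (Fin n) (Fin n) ℝ}, A.det ≠ 0 → l ≠ [] →
    (∀ v ∈ l, v ≠ 0) → ∃ X : AdmissibleCurve A (A * (l.map (expMap Q)).prod),
      curveLength (isoMetric μ μc κ) X = (l.map (isoNorm μ μc κ)).sum := by
  induction l with
  | nil => intro A _ h; exact absurd rfl h
  | cons v l ih =>
    intro A hA _ hl
    have hv := hl v List.mem_cons_self
    rcases eq_or_ne l [] with rfl | hne
    · have h1 : A * expMap Q v = A * ([v].map (expMap Q)).prod := by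
        rw [List.map_singleton, List.prod_singleton]
      rw [← h1, List.map_singleton, List.sum_singleton]
      exact exists_admissibleCurve_segment hQ hA hv
    · have hA' : (A * expMap Q v).det ≠ 0 := by
        rw [Matrix.det_mul]; exact mul_ne_zero hA (det_expMap_ne_zero v)
      obtain ⟨X, hX⟩ := ih hA' hne fun w hw => hl w (List.mem_cons_of_mem _ hw)
      obtain ⟨Z, hZ⟩ := exists_admissibleCurve_cons hQ hA hv X
      have h1 : A * expMap Q v * (l.map (expMap Q)).prod = A * ((v :: l).map (expMap Q)).prod := by
        rw [List.map_cons, List.prod_cons, mul_assoc]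
      rw [← h1, List.map_cons, List.sum_cons, ← hX]
      exact ⟨Z, hZ⟩

/-- Zero velocities are dropped because admissible curves must be regular; this changes neither the
product nor the length. Since `A ≠ B`, at least one segment is left. -/
theorem exists_admissibleCurve_of_prod_eq (hQ : IsGeodesicForm Q (isoBilin n μ μc κ))
    {A B : Matrix (Fin n) (Fin n) ℝ} (hA : A.det ≠ 0) (hAB : A ≠ B)
    (l : List (Matrix (Fin n) (Fin n) ℝ)) (hl : B = A * (l.map (expMap Q)).prod) :
    ∃ X : AdmissibleCurve A B,
      curveLength (isoMetric μ μc κ) X = (l.map (isoNorm μ μc κ)).sum := by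
  classical
  have hprod : ∀ l : List (Matrix (Fin n) (Fin n) ℝ),
      ((l.filter (· ≠ 0)).map (expMap Q)).prod = (l.map (expMap Q)).prod ∧
      ((l.filter (· ≠ 0)).map (isoNorm μ μc κ)).sum = (l.map (isoNorm μ μc κ)).sum := by
    intro l
    induction l with
    | nil => simp
    | cons v l ih =>
      by_cases hv : v = 0
      · subst hv
        have h0 : expMap Q (0 : Matrix (Fin n) (Fin n) ℝ) = 1 := expMap_zero Q
        rw [List.filter_cons_of_neg (by simp), ih.1, ih.2]
        simp only [List.map_cons, List.prod_cons, List.sum_cons, h0, one_mul, isoNorm_zero, zero_add,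
          and_self]
      · rw [List.filter_cons_of_pos (by simpa using hv)]
        simp only [List.map_cons, List.prod_cons, List.sum_cons, ih.1, ih.2, and_self]
  have hne : l.filter (· ≠ 0) ≠ [] := fun h => hAB (by
    rw [hl, ← (hprod l).1, h]; simp)
  have := exists_admissibleCurve_list hQ (l.filter (· ≠ 0)) hA hne (by simp)
  rwa [(hprod l).1, (hprod l).2, ← hl] at this

end BrokenGeodesic

/-! ### Minimisation over broken geodesics -/

/-- Existence of length minimisers, for a geodesic exponential map of the metric. -/
theorem exists_curveLength_le {μ μc κ : ℝ}
    {Q : Matrix (Fin n) (Fin n) ℝ →L[ℝ] Matrix (Fin n) (Fin n) ℝ}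
    (hQ : IsGeodesicForm Q (isoBilin n μ μc κ)) {A B : Matrix (Fin n) (Fin n) ℝ}
    (hA : 0 < A.det) (hB : 0 < B.det) (hAB : A ≠ B) :
    ∃ X : AdmissibleCurve A B, ∀ Y : AdmissibleCurve A B,
      curveLength (isoMetric μ μc κ) X ≤ curveLength (isoMetric μ μc κ) Y := by
  obtain ⟨r, hr, log, Ω, hlog⟩ := hQ.exists_isNormalChart
  obtain ⟨X₀⟩ : Nonempty (AdmissibleCurve A B) := by
    have hM : 0 < (A⁻¹ * B).det := by
      rw [Matrix.det_mul, Matrix.det_nonsing_inv, Ring.inverse_eq_inv']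
      positivity
    obtain ⟨l, hl⟩ := exists_list_expMap_prod_eq Q hM
    obtain ⟨X, -⟩ := exists_admissibleCurve_of_prod_eq hQ hA.ne' hAB l
      (by rw [hl, ← mul_assoc, Matrix.mul_nonsing_inv _ hA.ne'.isUnit, one_mul])
    exact ⟨X⟩
  -- `N` segments of length at most `r` suffice for every curve no longer than `X₀`.
  obtain ⟨N, hN⟩ := exists_nat_ge (curveLength (isoMetric μ μc κ) X₀ / r)
  rw [div_le_iff₀ hr] at hN
  let K : Set (Fin N → Matrix (Fin n) (Fin n) ℝ) :=
    {v | (∀ i, isoNorm μ μc κ (v i) ≤ r) ∧ A * (List.ofFn fun i => expMap Q (v i)).prod = B}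
  have hreplace : ∀ Y : AdmissibleCurve A B, curveLength (isoMetric μ μc κ) Y ≤ N * r →
      ∃ v ∈ K, ∑ i, isoNorm μ μc κ (v i) ≤ curveLength (isoMetric μ μc κ) Y := by
    intro Y hY
    obtain ⟨h1, h2, -⟩ := Y.hasBodyVelocity μ μc κ
    rw [Y.curveLength_eq] at hY ⊢
    obtain ⟨v, hv, hsum, hprod⟩ := hQ.exists_prod_expMap_eq hlog hr.le N h2 h1 hY
    exact ⟨v, ⟨hv, by rw [← Y.map_right, hprod, Y.map_left]⟩, hsum⟩
  have hKc : IsCompact K := by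
    have h1 : IsCompact (Set.pi univ fun _ : Fin N =>
        {x : Matrix (Fin n) (Fin n) ℝ | isoNorm μ μc κ x ≤ r}) :=
      isCompact_univ_pi fun _ => hQ.isCompact_le r
    have h2 : Continuous fun v : Fin N → Matrix (Fin n) (Fin n) ℝ =>
        A * (List.ofFn fun i => expMap Q (v i)).prod := by
      simp only [List.ofFn_eq_map]
      exact continuous_const.mul (continuous_list_prod _ fun i _ =>
        (continuous_expMap Q).comp (continuous_apply i))
    have h3 : K = (Set.pi univ fun _ : Fin N =>
        {x : Matrix (Fin n) (Fin n) ℝ | isoNorm μ μc κ x ≤ r}) ∩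
        (fun v => A * (List.ofFn fun i => expMap Q (v i)).prod) ⁻¹' {B} := by
      ext v; simp [K, Set.mem_pi]
    rw [h3]
    exact h1.inter_right (isClosed_singleton.preimage h2)
  obtain ⟨v₀, hv₀, hv₀'⟩ := hreplace X₀ hN
  obtain ⟨v, hv, hmin⟩ := hKc.exists_isMinOn ⟨v₀, hv₀⟩
    (f := fun v : Fin N → Matrix (Fin n) (Fin n) ℝ => ∑ i, isoNorm μ μc κ (v i))
    (continuous_finsetSum _ fun i _ =>
      (continuous_isoNorm μ μc κ).comp (continuous_apply i)).continuousOn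
  obtain ⟨X, hX⟩ := exists_admissibleCurve_of_prod_eq hQ hA.ne' hAB (List.ofFn v)
    (by rw [← hv.2, List.map_ofFn]; rfl)
  refine ⟨X, fun Y => ?_⟩
  have hXs : curveLength (isoMetric μ μc κ) X = ∑ i, isoNorm μ μc κ (v i) := by
    rw [hX, List.map_ofFn, List.sum_ofFn]; rfl
  rw [hXs]
  -- A curve `Y` longer than `N r` need not be replaced: it is at least as long as `X₀`, whose
  -- replacement `v₀` competes in the minimum.
  rcases le_total (curveLength (isoMetric μ μc κ) Y) (N * r) with h | h
  · obtain ⟨w, hw, hw'⟩ := hreplace Y h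
    exact (hmin hw).trans hw'
  · exact (hmin hv₀).trans (hv₀'.trans (hN.trans h))

end

end GLGeod

theorem mainTheorem4 (n : ℕ) (μ μc κ : ℝ) (hμ : 0 < μ) (hμc : 0 < μc) (hκ : 0 < κ)
    (A B : Matrix (Fin n) (Fin n) ℝ) (hA : 0 < A.det) (hB : 0 < B.det) (hAB : A ≠ B) :
    ∃ X : GLGeod.AdmissibleCurve A B,
      ENNReal.ofReal (GLGeod.curveLength (GLGeod.isoMetric μ μc κ) X) =
        GLGeod.geodDist (GLGeod.isoMetric μ μc κ) A B := by
  obtain ⟨X, hX⟩ := GLGeod.exists_curveLength_le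
    (GLGeod.isGeodesicForm_isoBilin (n := n) hμ hμc hκ) hA hB hAB
  exact ⟨X, le_antisymm (le_iInf fun Y => ENNReal.ofReal_le_ofReal (hX Y)) (iInf_le _ X)⟩
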